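/- Let $\mathbb{D}$ be a countably infinite set of data values; a trace is an infinite word over $\mathbb{D}$. Constraints are $b ::= \mathsf{true} \mid e = f \mid \neg b \mid b \wedge b$, where $e,f$ are data variables or the placeholder $\star$ for the current data value. Formulae are built from $\mathsf{tt}$, $\mathsf{ff}$, modalities $\langle b\rangle\varphi$ and $[b]\varphi$, quantifiers $\exists x.\varphi$ and $\forall x.\varphi$ over data values, $\vee$, $\wedge$, fixed points $\min X.\varphi$ and $\max X.\varphi$, and formula variables $X$. Relative to a data environment $\delta$ (values of the data variables) and a trace environment $\rho$ (which maps each formula variable to a function from data environments to sets of traces), a trace $d\,u$ with first value $d$ satisfies $\langle b\rangle\varphi$ if $b$ holds under $\delta[\star\mapsto d]$ and $u$ satisfies $\varphi$; it satisfies $[b]\varphi$ if $u$ satisfies $\varphi$ whenever $b$ holds under $\delta[\star\mapsto d]$; Boolean connectives and quantifiers have their usual meaning; $X$ denotes $\rho(X)(\delta)$; and $\min X.\varphi$, $\max X.\varphi$ denote the least and the greatest fixed point of the operator $F\mapsto(\delta'\mapsto[\![\varphi]\!]_{\rho[X\mapsto F],\delta'})$ on functions $F$ from data environments to sets of traces,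 applied to $\delta$. A closed formula is valid if all traces satisfy it, and satisfiable if some trace does. The fragment disjHMLd has the grammar $\varphi ::= \mathsf{tt} \mid \langle b\rangle\varphi \mid \exists x.\varphi \mid \varphi\vee\varphi \mid \min X.\varphi \mid X$, and conjHMLd is its dual, $\varphi ::= \mathsf{ff} \mid [b]\varphi \mid \forall x.\varphi \mid \varphi\wedge\varphi \mid \max X.\varphi \mid X$. The dual $\overline{\varphi}$ of a formula exchanges $\mathsf{tt}/\mathsf{ff}$, $\langle b\rangle/[b]$, $\exists/\forall$, $\vee/\wedge$ and $\min/\max$. Theorem. The following holds, even when the inputs are restricted to closed formulae in which every fixed-point variable is bound once and occurs only under a modality inside its defining fixed-point formula. 1. The validity problem for disjHMLd (given a formula in disjHMLd, is it valid?) is undecidable. 2. The satisfiability problem for conjHMLd is undecidable. 3. These problems are complementary under dualisation: $\overline{\overline{\varphi}}=\varphi$, dualisation preserves the input restrictions and exchanges disjHMLd and conjHMLd, and a closed formula $\varphi$ is valid if and only if $\overline{\varphi}$ is not satisfiable. 4. Every recursively enumerable predicate on $\mathbb{N}$ (for instance, halting of deterministic Turing machines) is many-one reducible to the problem in 1, and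 its complement (for instance, non-halting) is many-one reducible to the problem in 2. -/

import Mathlib

namespace RecHMLd

/-- Terms `e ::= x | ⋆`: a data variable, or the placeholder for the current data value. -/
inductive Term : Type
  | star : Term
  | dvar : ℕ → Term

/-- Constraint expressions `b ::= true | e = f | ¬ b | b ∧ c`. -/
inductive BExp : Type
  | tru : BExp
  | eq : Term → Term → BExp
  | neg : BExp → BExp
  | and : BExp → BExp → BExp

/-- Formulae of recHMLd. Data variables and formula variables are two disjoint countable
supplies of names, both indexed by `ℕ`. -/
inductive Formula : Type
  | tt : Formula
  | ff : Formula
  /-- possibility `⟨b⟩ φ` -/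
  | dia : BExp → Formula → Formula
  /-- necessity `[b] φ` -/
  | box : BExp → Formula → Formula
  /-- `∃ x. φ` over data values -/
  | ex : ℕ → Formula → Formula
  /-- `∀ x. φ` over data values -/
  | all : ℕ → Formula → Formula
  | or : Formula → Formula → Formula
  | and : Formula → Formula → Formula
  /-- `min X. φ` -/
  | lfp : ℕ → Formula → Formula
  /-- `max X. φ` -/
  | gfp : ℕ → Formula → Formula
  /-- a formula variable `X` -/
  | fvar : ℕ → Formula

/-! ### Semantics -/

section Semantics

variable {D : Type*}

/-- Infinite traces: data `ω`-words. -/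
abbrev Trace (D : Type*) : Type _ := ℕ → D

/-- Data environments. They are total here: a formula is only ever interpreted in environments
that are defined on its free data variables, and the values elsewhere are irrelevant. -/
abbrev DEnv (D : Type*) : Type _ := ℕ → D

/-- Data interpretations, a complete lattice under pointwise inclusion. -/
abbrev DInt (D : Type*) : Type _ := DEnv D → Set (Trace D)

/-- Trace environments. -/
abbrev TEnv (D : Type*) : Type _ := ℕ → DInt D

/-- The value of a term in the environment `δ[⋆ ↦ d]`. -/
def Term.val (δ : DEnv D) (d : D) : Term → D
  | .star => d
  | .dvar x => δ x

/-- `b δ[⋆ ↦ d]` evaluates to true. -/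
def BExp.Holds (δ : DEnv D) (d : D) : BExp → Prop
  | .tru => True
  | .eq e f => e.val δ d = f.val δ d
  | .neg b => ¬ b.Holds δ d
  | .and b c => b.Holds δ d ∧ c.Holds δ d

/-- The trace `u` with its first value removed; `u` is `(u 0)` followed by `tail u`. -/
def tail (u : Trace D) : Trace D := fun n => u (n + 1)

/-- The linear-time semantics of recHMLd: the set of traces denoted by a formula, given a trace
environment and a data environment. -/
def Formula.sem : Formula → TEnv D → DEnv D → Set (Trace D)
  | .tt, _, _ => Set.univ
  | .ff, _, _ => ∅
  | .dia b φ, ρ, δ => {t | b.Holds δ (t 0) ∧ tail t ∈ φ.sem ρ δ}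
  | .box b φ, ρ, δ => {t | b.Holds δ (t 0) → tail t ∈ φ.sem ρ δ}
  | .ex x φ, ρ, δ => ⋃ d : D, φ.sem ρ (Function.update δ x d)
  | .all x φ, ρ, δ => ⋂ d : D, φ.sem ρ (Function.update δ x d)
  | .or φ ψ, ρ, δ => φ.sem ρ δ ∪ ψ.sem ρ δ
  | .and φ ψ, ρ, δ => φ.sem ρ δ ∩ ψ.sem ρ δ
  | .lfp X φ, ρ, δ => sInf {F : DInt D | (fun δ' => φ.sem (Function.update ρ X F) δ') ≤ F} δ
  | .gfp X φ, ρ, δ => sSup {F : DInt D | F ≤ (fun δ' => φ.sem (Function.update ρ X F) δ')} δ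
  | .fvar X, ρ, δ => ρ X δ

/-- Every trace satisfies `φ`. (For closed `φ` the environments are irrelevant.) -/
def Valid (D : Type*) (φ : Formula) : Prop :=
  ∀ (ρ : TEnv D) (δ : DEnv D) (t : Trace D), t ∈ φ.sem ρ δ

/-- Some trace satisfies `φ`. (For closed `φ` the environments are irrelevant.) -/
def Satisfiable (D : Type*) (φ : Formula) : Prop :=
  ∃ (ρ : TEnv D) (δ : DEnv D) (t : Trace D), t ∈ φ.sem ρ δ

end Semantics

/-! ### Fragments and the dual of a formula -/

/-- The fragment disjHMLd: `tt | ⟨b⟩φ | ∃x.φ | φ ∨ ψ | min X.φ | X`. -/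
def Formula.IsDisj : Formula → Prop
  | .tt => True
  | .dia _ φ => φ.IsDisj
  | .ex _ φ => φ.IsDisj
  | .or φ ψ => φ.IsDisj ∧ ψ.IsDisj
  | .lfp _ φ => φ.IsDisj
  | .fvar _ => True
  | _ => False

/-- The dual fragment conjHMLd: `ff | [b]φ | ∀x.φ | φ ∧ ψ | max X.φ | X`. -/
def Formula.IsConj : Formula → Prop
  | .ff => True
  | .box _ φ => φ.IsConj
  | .all _ φ => φ.IsConj
  | .and φ ψ => φ.IsConj ∧ ψ.IsConj
  | .gfp _ φ => φ.IsConj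
  | .fvar _ => True
  | _ => False

/-- The dual formula: every operator is exchanged with its De Morgan dual. -/
def Formula.dual : Formula → Formula
  | .tt => .ff
  | .ff => .tt
  | .dia b φ => .box b φ.dual
  | .box b φ => .dia b φ.dual
  | .ex x φ => .all x φ.dual
  | .all x φ => .ex x φ.dual
  | .or φ ψ => .and φ.dual ψ.dual
  | .and φ ψ => .or φ.dual ψ.dual
  | .lfp X φ => .gfp X φ.dual
  | .gfp X φ => .lfp X φ.dual
  | .fvar X => .fvar X

/-! ### Closed formulae and the standing conventions on them -/

/-- Data variables of a term. -/
def Term.vars : Term → Finset ℕ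
  | .star => ∅
  | .dvar x => {x}

/-- Data variables of a constraint. -/
def BExp.vars : BExp → Finset ℕ
  | .tru => ∅
  | .eq e f => e.vars ∪ f.vars
  | .neg b => b.vars
  | .and b c => b.vars ∪ c.vars

/-- Free data variables. -/
def Formula.freeDVars : Formula → Finset ℕ
  | .tt => ∅
  | .ff => ∅
  | .dia b φ => b.vars ∪ φ.freeDVars
  | .box b φ => b.vars ∪ φ.freeDVars
  | .ex x φ => φ.freeDVars.erase x
  | .all x φ => φ.freeDVars.erase x
  | .or φ ψ => φ.freeDVars ∪ ψ.freeDVars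
  | .and φ ψ => φ.freeDVars ∪ ψ.freeDVars
  | .lfp _ φ => φ.freeDVars
  | .gfp _ φ => φ.freeDVars
  | .fvar _ => ∅

/-- Free formula variables. -/
def Formula.freeFVars : Formula → Finset ℕ
  | .tt => ∅
  | .ff => ∅
  | .dia _ φ => φ.freeFVars
  | .box _ φ => φ.freeFVars
  | .ex _ φ => φ.freeFVars
  | .all _ φ => φ.freeFVars
  | .or φ ψ => φ.freeFVars ∪ ψ.freeFVars
  | .and φ ψ => φ.freeFVars ∪ ψ.freeFVars
  | .lfp X φ => φ.freeFVars.erase X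
  | .gfp X φ => φ.freeFVars.erase X
  | .fvar X => {X}

/-- Formula variables with a free occurrence that is not in the scope of a modal operator. -/
def Formula.unguardedFVars : Formula → Finset ℕ
  | .tt => ∅
  | .ff => ∅
  | .dia _ _ => ∅
  | .box _ _ => ∅
  | .ex _ φ => φ.unguardedFVars
  | .all _ φ => φ.unguardedFVars
  | .or φ ψ => φ.unguardedFVars ∪ ψ.unguardedFVars
  | .and φ ψ => φ.unguardedFVars ∪ ψ.unguardedFVars
  | .lfp X φ => φ.unguardedFVars.erase X
  | .gfp X φ => φ.unguardedFVars.erase X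
  | .fvar X => {X}

/-- Every occurrence of a fixed-point variable is within the scope of a modal operator inside its
defining fixed-point formula. -/
def Formula.Guarded : Formula → Prop
  | .tt => True
  | .ff => True
  | .dia _ φ => φ.Guarded
  | .box _ φ => φ.Guarded
  | .ex _ φ => φ.Guarded
  | .all _ φ => φ.Guarded
  | .or φ ψ => φ.Guarded ∧ ψ.Guarded
  | .and φ ψ => φ.Guarded ∧ ψ.Guarded
  | .lfp X φ => X ∉ φ.unguardedFVars ∧ φ.Guarded
  | .gfp X φ => X ∉ φ.unguardedFVars ∧ φ.Guarded
  | .fvar _ => True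

/-- The formula variables bound by the fixed-point operators of a formula, one entry for each
operator. -/
def Formula.binders : Formula → List ℕ
  | .tt => []
  | .ff => []
  | .dia _ φ => φ.binders
  | .box _ φ => φ.binders
  | .ex _ φ => φ.binders
  | .all _ φ => φ.binders
  | .or φ ψ => φ.binders ++ ψ.binders
  | .and φ ψ => φ.binders ++ ψ.binders
  | .lfp X φ => X :: φ.binders
  | .gfp X φ => X :: φ.binders
  | .fvar _ => []

/-- Closed formulae, without free data variables and without free formula variables. -/
def Formula.Closed (φ : Formula) : Prop :=
  φ.freeDVars = ∅ ∧ φ.freeFVars = ∅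

/-- Closed formulae in which recursion is guarded and every formula variable is bound at most
once. -/
def Formula.IsSentence (φ : Formula) : Prop :=
  φ.Closed ∧ φ.Guarded ∧ φ.binders.Nodup

/-! ### Formulae as inputs of algorithms

An explicit arithmetical coding of the syntax by natural numbers. All three codings are
bijections with `ℕ`, which makes the types `Primcodable`. -/

/-- Gödel numbers of terms. -/
def Term.code : Term → ℕ
  | .star => 0
  | .dvar x => x + 1

/-- The term with a given Gödel number. -/
def Term.ofCode : ℕ → Term
  | 0 => .star
  | x + 1 => .dvar x

theorem Term.ofCode_code (e : Term) : Term.ofCode e.code = e := by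
  cases e <;> rfl

theorem Term.code_ofCode (n : ℕ) : (Term.ofCode n).code = n := by
  cases n <;> rfl

instance : Denumerable Term :=
  Denumerable.mk' ⟨Term.code, Term.ofCode, Term.ofCode_code, Term.code_ofCode⟩

/-- Gödel numbers of constraints. -/
def BExp.code : BExp → ℕ
  | .tru => 0
  | .eq e f => 3 * Nat.pair e.code f.code + 0 + 1
  | .neg b => 3 * b.code + 1 + 1
  | .and b c => 3 * Nat.pair b.code c.code + 2 + 1

/-- The constraint with a given Gödel number. -/
def BExp.ofCode : ℕ → BExp
  | 0 => .tru
  | n + 1 =>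
    have _h : n / 3 < n + 1 := Nat.lt_succ_of_le (Nat.div_le_self n 3)
    have _h1 : (n / 3).unpair.1 < n + 1 := lt_of_le_of_lt (Nat.unpair_left_le _) _h
    have _h2 : (n / 3).unpair.2 < n + 1 := lt_of_le_of_lt (Nat.unpair_right_le _) _h
    match n % 3 with
    | 0 => .eq (Term.ofCode (n / 3).unpair.1) (Term.ofCode (n / 3).unpair.2)
    | 1 => .neg (BExp.ofCode (n / 3))
    | _ => .and (BExp.ofCode (n / 3).unpair.1) (BExp.ofCode (n / 3).unpair.2)

theorem BExp.ofCode_code (b : BExp) : BExp.ofCode b.code = b := by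
  induction b with
  | tru => simp [BExp.code, BExp.ofCode]
  | eq e f =>
    have h1 : ∀ m : ℕ, (3 * m) % 3 = 0 := by intro m; omega
    have h2 : ∀ m : ℕ, (3 * m) / 3 = m := by intro m; omega
    rw [BExp.code, BExp.ofCode]
    simp only [h1, h2, Nat.unpair_pair, Term.ofCode_code]
  | neg b ih =>
    have h1 : ∀ m : ℕ, (3 * m + 1) % 3 = 1 := by intro m; omega
    have h2 : ∀ m : ℕ, (3 * m + 1) / 3 = m := by intro m; omega
    rw [BExp.code, BExp.ofCode]
    simp only [h1, h2, ih]
  | and b c ihb ihc =>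
    have h1 : ∀ m : ℕ, (3 * m + 2) % 3 = 2 := by intro m; omega
    have h2 : ∀ m : ℕ, (3 * m + 2) / 3 = m := by intro m; omega
    rw [BExp.code, BExp.ofCode]
    simp only [h1, h2, Nat.unpair_pair, ihb, ihc]

theorem BExp.code_ofCode (n : ℕ) : (BExp.ofCode n).code = n := by
  induction n using Nat.strong_induction_on with
  | _ n ih =>
    cases n with
    | zero => simp [BExp.code, BExp.ofCode]
    | succ n =>
      have h : n / 3 < n + 1 := Nat.lt_succ_of_le (Nat.div_le_self n 3)
      have h1 := lt_of_le_of_lt (Nat.unpair_left_le (n / 3)) h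
      have h2 := lt_of_le_of_lt (Nat.unpair_right_le (n / 3)) h
      rw [BExp.ofCode]
      have hn : n % 3 = 0 ∨ n % 3 = 1 ∨ n % 3 = 2 := by omega
      rcases hn with e | e | e <;> simp only [e, BExp.code, Term.code_ofCode, ih _ h, ih _ h1, ih _ h2,
        Nat.pair_unpair] <;> omega

instance : Denumerable BExp :=
  Denumerable.mk' ⟨BExp.code, BExp.ofCode, BExp.ofCode_code, BExp.code_ofCode⟩

/-- Gödel numbers of formulae. -/
def Formula.code : Formula → ℕ
  | .tt => 0
  | .ff => 1
  | .dia b φ => 9 * Nat.pair b.code φ.code + 0 + 2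
  | .box b φ => 9 * Nat.pair b.code φ.code + 1 + 2
  | .ex x φ => 9 * Nat.pair x φ.code + 2 + 2
  | .all x φ => 9 * Nat.pair x φ.code + 3 + 2
  | .or φ ψ => 9 * Nat.pair φ.code ψ.code + 4 + 2
  | .and φ ψ => 9 * Nat.pair φ.code ψ.code + 5 + 2
  | .lfp X φ => 9 * Nat.pair X φ.code + 6 + 2
  | .gfp X φ => 9 * Nat.pair X φ.code + 7 + 2
  | .fvar X => 9 * X + 8 + 2

/-- The formula with a given Gödel number. -/
def Formula.ofCode : ℕ → Formula
  | 0 => .tt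
  | 1 => .ff
  | n + 2 =>
    have _h : n / 9 < n + 2 := lt_of_le_of_lt (Nat.div_le_self n 9) (by omega)
    have _h1 : (n / 9).unpair.1 < n + 2 := lt_of_le_of_lt (Nat.unpair_left_le _) _h
    have _h2 : (n / 9).unpair.2 < n + 2 := lt_of_le_of_lt (Nat.unpair_right_le _) _h
    match n % 9 with
    | 0 => .dia (BExp.ofCode (n / 9).unpair.1) (Formula.ofCode (n / 9).unpair.2)
    | 1 => .box (BExp.ofCode (n / 9).unpair.1) (Formula.ofCode (n / 9).unpair.2)
    | 2 => .ex (n / 9).unpair.1 (Formula.ofCode (n / 9).unpair.2)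
    | 3 => .all (n / 9).unpair.1 (Formula.ofCode (n / 9).unpair.2)
    | 4 => .or (Formula.ofCode (n / 9).unpair.1) (Formula.ofCode (n / 9).unpair.2)
    | 5 => .and (Formula.ofCode (n / 9).unpair.1) (Formula.ofCode (n / 9).unpair.2)
    | 6 => .lfp (n / 9).unpair.1 (Formula.ofCode (n / 9).unpair.2)
    | 7 => .gfp (n / 9).unpair.1 (Formula.ofCode (n / 9).unpair.2)
    | _ => .fvar (n / 9)

theorem Formula.ofCode_code (φ : Formula) : Formula.ofCode φ.code = φ := by
  have hmod : ∀ m r : ℕ, r < 9 → (9 * m + r) % 9 = r := by intro m r hr; omega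
  have hdiv : ∀ m r : ℕ, r < 9 → (9 * m + r) / 9 = m := by intro m r hr; omega
  have hmod0 : ∀ m : ℕ, (9 * m) % 9 = 0 := by intro m; omega
  have hdiv0 : ∀ m : ℕ, (9 * m) / 9 = m := by intro m; omega
  induction φ with
  | tt => simp [Formula.code, Formula.ofCode]
  | ff => simp [Formula.code, Formula.ofCode]
  | dia b φ ih =>
    rw [Formula.code, Formula.ofCode]
    simp only [hmod0, hdiv0, Nat.unpair_pair,
      BExp.ofCode_code, ih]
  | box b φ ih =>
    rw [Formula.code, Formula.ofCode]
    simp only [hmod _ 1 (by norm_num), hdiv _ 1 (by norm_num), Nat.unpair_pair,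
      BExp.ofCode_code, ih]
  | ex x φ ih =>
    rw [Formula.code, Formula.ofCode]
    simp only [hmod _ 2 (by norm_num), hdiv _ 2 (by norm_num), Nat.unpair_pair, ih]
  | all x φ ih =>
    rw [Formula.code, Formula.ofCode]
    simp only [hmod _ 3 (by norm_num), hdiv _ 3 (by norm_num), Nat.unpair_pair, ih]
  | or φ ψ ih1 ih2 =>
    rw [Formula.code, Formula.ofCode]
    simp only [hmod _ 4 (by norm_num), hdiv _ 4 (by norm_num), Nat.unpair_pair, ih1, ih2]
  | and φ ψ ih1 ih2 =>
    rw [Formula.code, Formula.ofCode]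
    simp only [hmod _ 5 (by norm_num), hdiv _ 5 (by norm_num), Nat.unpair_pair, ih1, ih2]
  | lfp X φ ih =>
    rw [Formula.code, Formula.ofCode]
    simp only [hmod _ 6 (by norm_num), hdiv _ 6 (by norm_num), Nat.unpair_pair, ih]
  | gfp X φ ih =>
    rw [Formula.code, Formula.ofCode]
    simp only [hmod _ 7 (by norm_num), hdiv _ 7 (by norm_num), Nat.unpair_pair, ih]
  | fvar X =>
    rw [Formula.code, Formula.ofCode]
    simp only [hmod _ 8 (by norm_num), hdiv _ 8 (by norm_num)]

theorem Formula.code_ofCode (n : ℕ) : (Formula.ofCode n).code = n := by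
  induction n using Nat.strong_induction_on with
  | _ n ih =>
    match n, ih with
    | 0, _ => simp [Formula.code, Formula.ofCode]
    | 1, _ => simp [Formula.code, Formula.ofCode]
    | n + 2, ih =>
      have h : n / 9 < n + 2 := lt_of_le_of_lt (Nat.div_le_self n 9) (by omega)
      have h1 := lt_of_le_of_lt (Nat.unpair_left_le (n / 9)) h
      have h2 := lt_of_le_of_lt (Nat.unpair_right_le (n / 9)) h
      rw [Formula.ofCode]
      have hn : n % 9 = 0 ∨ n % 9 = 1 ∨ n % 9 = 2 ∨ n % 9 = 3 ∨ n % 9 = 4 ∨ n % 9 = 5 ∨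
          n % 9 = 6 ∨ n % 9 = 7 ∨ n % 9 = 8 := by omega
      rcases hn with e | e | e | e | e | e | e | e | e <;>
        simp only [e, Formula.code, BExp.code_ofCode, ih _ h1, ih _ h2,
        Nat.pair_unpair] <;> omega

instance : Denumerable Formula :=
  Denumerable.mk' ⟨Formula.code, Formula.ofCode, Formula.ofCode_code, Formula.code_ofCode⟩

/-! ### Decision problems -/

/-- The problem "given a formula in the class `S`, does it have the property `P`?" is undecidable:
no computable function answers it correctly on all the instances. Its answers on formulae outside
`S` are not constrained, so a smaller class `S` gives a stronger claim. -/
def Undecidable (S P : Formula → Prop) : Prop :=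
  ¬ ∃ f : Formula → Bool, Computable f ∧ ∀ φ, S φ → (f φ = true ↔ P φ)

/-- The predicate `p` is many-one reducible to the problem "given a formula in the class `S`, does
it have the property `P`?". -/
def ReducesTo (p : ℕ → Prop) (S P : Formula → Prop) : Prop :=
  ∃ f : ℕ → Formula, Computable f ∧ ∀ n, S (f n) ∧ (p n ↔ P (f n))

end RecHMLd

namespace RecHMLd

/-! ### Dualisation -/

namespace Formula

/-! All four parts come from one reduction. For an r.e. predicate `p` there is a code whose
evaluation on `[n]` terminates iff `p n`. Its run is written as an append-only log: each step adds a
record, with one of finitely many tags and three pointers to earlier records, that is determined by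
the last record and one record to which the last one points. Numbers, lists and continuations are
linked structures in the log, so nothing is ever overwritten (`evaluator_stuck_iff`).

A log becomes a trace when each record gets a data value as its identity and pointers are written as
the identities of their targets. Failing to be an endless correct log is an existential property:
the beginning is wrong, or there are a block `j` and an earlier block `i` that `j` looks up, and
block `j + 1` is not the prescribed one. Nested eventualities and stored data values express this in
disjHMLd; Boolean combinations are needed in constraints only. If the machine gets stuck, every
trace has an error (`action_ne_none_of_no_error`); if it runs forever, its log with pairwise
distinct identities has none (`not_errorAt_trace`). This is `valid_formula_iff`.

A dual formula denotes the complement (`sem_dual`), which turns validity into unsatisfiability.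
Undecidability follows by taking an r.e. predicate that is not computable. -/

theorem dual_dual (φ : Formula) : φ.dual.dual = φ := by
  induction φ <;> simp_all [dual]

theorem isConj_dual_iff (φ : Formula) : φ.dual.IsConj ↔ φ.IsDisj := by
  induction φ <;> simp_all [dual, IsConj, IsDisj]

theorem freeDVars_dual (φ : Formula) : φ.dual.freeDVars = φ.freeDVars := by
  induction φ <;> simp_all [dual, freeDVars]

theorem freeFVars_dual (φ : Formula) : φ.dual.freeFVars = φ.freeFVars := by
  induction φ <;> simp_all [dual, freeFVars]

theorem unguardedFVars_dual (φ : Formula) : φ.dual.unguardedFVars = φ.unguardedFVars := by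
  induction φ <;> simp_all [dual, unguardedFVars]

theorem guarded_dual_iff (φ : Formula) : φ.dual.Guarded ↔ φ.Guarded := by
  induction φ <;> simp_all [dual, Guarded, unguardedFVars_dual]

theorem binders_dual (φ : Formula) : φ.dual.binders = φ.binders := by
  induction φ <;> simp_all [dual, binders]

theorem isSentence_dual_iff (φ : Formula) : φ.dual.IsSentence ↔ φ.IsSentence := by
  simp [IsSentence, Closed, freeDVars_dual, freeFVars_dual, guarded_dual_iff, binders_dual]

variable {D : Type*}

theorem mem_sem_lfp {X : ℕ} {φ : Formula} {ρ : TEnv D} {δ : DEnv D} {t : Trace D} :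
    t ∈ (lfp X φ).sem ρ δ ↔
      ∀ F : DInt D, (∀ δ', φ.sem (Function.update ρ X F) δ' ⊆ F δ') → t ∈ F δ := by
  simp only [sem, sInf_apply, Set.iInf_eq_iInter, Set.mem_iInter, Subtype.forall]
  rfl

theorem mem_sem_gfp {X : ℕ} {φ : Formula} {ρ : TEnv D} {δ : DEnv D} {t : Trace D} :
    t ∈ (gfp X φ).sem ρ δ ↔
      ∃ F : DInt D, (∀ δ', F δ' ⊆ φ.sem (Function.update ρ X F) δ') ∧ t ∈ F δ := by
  simp only [sem, sSup_apply, Set.iSup_eq_iUnion, Set.mem_iUnion, Subtype.exists]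
  constructor
  · rintro ⟨F, h, ht⟩
    exact ⟨F, h, ht⟩
  · rintro ⟨F, h, ht⟩
    exact ⟨F, h, ht⟩

theorem update_compl (ρ : TEnv D) (X : ℕ) (F : DInt D) :
    (Function.update ρ X F)ᶜ = Function.update ρᶜ X Fᶜ := by
  funext Y
  by_cases h : Y = X
  · subst h; simp
  · simp [h]

/-- The dual formula denotes the complement. -/
theorem sem_dual (φ : Formula) (ρ : TEnv D) (δ : DEnv D) :
    φ.dual.sem ρᶜ δ = (φ.sem ρ δ)ᶜ := by
  induction φ generalizing ρ δ with
  | tt => simp [dual, sem]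
  | ff => simp [dual, sem]
  | dia b φ ih =>
    ext t
    simp [dual, sem, ih]
  | box b φ ih =>
    ext t
    simp [dual, sem, ih]
  | ex x φ ih => simp [dual, sem, ih]
  | all x φ ih => simp [dual, sem, ih]
  | or φ ψ ih1 ih2 => simp [dual, sem, ih1, ih2]
  | and φ ψ ih1 ih2 => simp [dual, sem, ih1, ih2, Set.compl_inter]
  | lfp X φ ih =>
    ext t
    rw [dual, mem_sem_gfp, Set.mem_compl_iff, mem_sem_lfp]
    push Not
    -- Complementation exchanges post-fixed points of the dual operator and pre-fixed points of the
    -- original one, so `Fᶜ` is the witness in both directions.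
    refine ⟨fun ⟨F, h, ht⟩ => ⟨Fᶜ, fun δ' => ?_, not_not_intro ht⟩, fun ⟨F, h, ht⟩ => ⟨Fᶜ, fun δ' => ?_, ht⟩⟩
    · have := h δ'
      rw [← compl_compl F, ← update_compl, ih] at this
      simpa using Set.compl_subset_compl.2 this
    · rw [← update_compl, ih]
      exact Set.compl_subset_compl.2 (h δ')
  | gfp X φ ih =>
    ext t
    rw [dual, mem_sem_lfp, Set.mem_compl_iff, mem_sem_gfp]
    push Not
    refine ⟨fun h F hF ht => h Fᶜ (fun δ' => ?_) ht, fun h F hF => by_contra fun ht =>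
      h Fᶜ (fun δ' => ?_) ht⟩
    · rw [← update_compl, ih]
      exact Set.compl_subset_compl.2 (hF δ')
    · have := hF δ'
      rw [← compl_compl F, ← update_compl, ih] at this
      simpa using Set.compl_subset_compl.2 this
  | fvar X => simp [dual, sem]

end Formula

/-- Closedness plays no role: both sides quantify over all environments, and complementation
permutes the trace environments. -/
theorem valid_iff_not_satisfiable_dual (D : Type*) (φ : Formula) :
    Valid D φ ↔ ¬ Satisfiable D φ.dual := by
  simp only [Valid, Satisfiable, not_exists]
  constructor
  · intro h ρ δ t ht
    rw [← compl_compl ρ, Formula.sem_dual] at ht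
    exact ht (h _ _ _)
  · intro h ρ δ t
    by_contra ht
    refine h ρᶜ δ t ?_
    rw [Formula.sem_dual]
    exact ht

/-! ### Disjunctions of constraints -/

namespace BExp

/-- The disjunction of a list of constraints. -/
def any : List BExp → BExp
  | [] => neg tru
  | b :: l => neg (and (neg b) (neg (any l)))

/-- The constraint `x = y` between data variables. -/
def eqv (x y : ℕ) : BExp := eq (Term.dvar x) (Term.dvar y)

variable {D : Type*} {δ : DEnv D} {d : D}

theorem holds_any {l : List BExp} : (any l).Holds δ d ↔ ∃ b ∈ l, b.Holds δ d := by
  induction l with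
  | nil => simp [any, Holds]
  | cons b l ih => simp [any, Holds, ih, imp_iff_not_or]

theorem vars_any_subset {l : List BExp} {s : Finset ℕ} (h : ∀ b ∈ l, b.vars ⊆ s) :
    (any l).vars ⊆ s := by
  induction l with
  | nil => simp [any, vars]
  | cons b l ih =>
    simp only [any, vars]
    exact Finset.union_subset (h b (by simp)) (ih fun c hc => h c (by simp [hc]))

theorem vars_eqv_subset {x y : ℕ} {s : Finset ℕ} (hx : x ∈ s) (hy : y ∈ s) :
    (eqv x y).vars ⊆ s := by
  simp [eqv, vars, Term.vars, Finset.insert_subset_iff, hx, hy]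

end BExp

/-! ### Derived operators of disjHMLd -/

namespace Formula

/-- Skip `m` values. -/
def skip (m : ℕ) (φ : Formula) : Formula := (dia BExp.tru)^[m] φ

/-- Store the current value in the variable `x`. -/
def read (x : ℕ) (φ : Formula) : Formula := ex x (dia (BExp.eq Term.star (Term.dvar x)) φ)

/-- Store the next `m` values in the variables `s, s + 1, …`. -/
def readN : ℕ → ℕ → Formula → Formula
  | _, 0, φ => φ
  | s, m + 1, φ => read s (readN (s + 1) m φ)

/-- Eventually, after a multiple of `m` values, `φ`. -/
def ev (X m : ℕ) (φ : Formula) : Formula := lfp X (or φ (skip m (fvar X)))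

theorem skip_succ (m : ℕ) (φ : Formula) : skip (m + 1) φ = dia BExp.tru (skip m φ) :=
  Function.iterate_succ_apply' _ _ _

end Formula

/-! ### Semantics of the derived operators -/

section

variable {D : Type*}

/-- The trace `t` without its first `m` values. -/
def shift (m : ℕ) (t : Trace D) : Trace D := fun i => t (m + i)

theorem shift_shift (m n : ℕ) (t : Trace D) : shift m (shift n t) = shift (n + m) t := by
  funext i
  simp [shift, add_assoc]

theorem shift_zero (t : Trace D) : shift 0 t = t := by
  funext i
  simp [shift]

theorem tail_eq_shift (t : Trace D) : tail t = shift 1 t := by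
  funext i
  simp [shift, tail, add_comm]

/-- The environment `δ` with the variables `s, …, s + m - 1` set to the first values of `t`. -/
def store (s m : ℕ) (t : Trace D) (δ : DEnv D) : DEnv D :=
  fun x => if s ≤ x ∧ x < s + m then t (x - s) else δ x

theorem store_succ (s m : ℕ) (t : Trace D) (δ : DEnv D) :
    store (s + 1) m (shift 1 t) (Function.update δ s (t 0)) = store s (m + 1) t δ := by
  funext x
  by_cases h : x = s
  · subst h
    simp [store]
  · by_cases h' : s + 1 ≤ x ∧ x < s + 1 + m
    · rw [store, store, if_pos h', if_pos (by omega), shift]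
      congr 1
      omega
    · rw [store, store, if_neg h', if_neg (by omega), Function.update_of_ne h]

namespace Formula

variable {ρ : TEnv D} {δ : DEnv D} {t : Trace D} {φ : Formula}

theorem mem_sem_skip {m : ℕ} : t ∈ (skip m φ).sem ρ δ ↔ shift m t ∈ φ.sem ρ δ := by
  induction m generalizing t with
  | zero => simp [skip, shift_zero]
  | succ m ih =>
    rw [skip_succ]
    simp [sem, BExp.Holds, ih, tail_eq_shift, shift_shift, add_comm]

theorem mem_sem_read {x : ℕ} :
    t ∈ (read x φ).sem ρ δ ↔ shift 1 t ∈ φ.sem ρ (Function.update δ x (t 0)) := by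
  simp [read, sem, BExp.Holds, Term.val, tail_eq_shift]

theorem mem_sem_readN {s m : ℕ} :
    t ∈ (readN s m φ).sem ρ δ ↔ shift m t ∈ φ.sem ρ (store s m t δ) := by
  induction m generalizing s t δ with
  | zero =>
    have : store s 0 t δ = δ := by
      funext x
      rw [store, if_neg (by omega)]
    simp [readN, shift_zero, this]
  | succ m ih => rw [readN, mem_sem_read, ih, shift_shift, store_succ, add_comm]

/-- By hypothesis the meaning of `φ` does not depend on the trace environment, hence not on `X`. The
least fixed point is then the union of the preimages of `S` under all shifts by multiples of `m`. -/
theorem mem_sem_ev {X m : ℕ} {S : DEnv D → Set (Trace D)} (h : ∀ ρ δ, φ.sem ρ δ = S δ) :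
    t ∈ (ev X m φ).sem ρ δ ↔ ∃ k, shift (m * k) t ∈ φ.sem ρ δ := by
  simp only [ev, mem_sem_lfp, h]
  constructor
  · intro hF
    refine hF (fun δ' => {t | ∃ k, shift (m * k) t ∈ S δ'}) fun δ' u hu => ?_
    rcases hu with hu | hu
    · rw [h] at hu
      exact ⟨0, by simpa [shift_zero] using hu⟩
    · rw [mem_sem_skip] at hu
      simp only [sem, Function.update_self] at hu
      obtain ⟨k, hk⟩ := hu
      rw [shift_shift] at hk
      exact ⟨k + 1, by rwa [mul_add, mul_one, add_comm]⟩
  · rintro ⟨k, hk⟩ F hF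
    induction k generalizing t with
    | zero => exact hF δ (Or.inl (by simpa [h, shift_zero] using hk))
    | succ k ih =>
      refine hF δ (Or.inr ?_)
      rw [mem_sem_skip]
      simp only [sem, Function.update_self]
      exact ih (by rwa [shift_shift, add_comm, ← mul_one m, mul_assoc, one_mul, ← mul_add])

end Formula

end

/-! ### Syntactic side conditions for the derived operators -/

namespace Formula

variable {φ : Formula}

theorem isDisj_skip {m : ℕ} : (skip m φ).IsDisj ↔ φ.IsDisj := by
  induction m with
  | zero => rfl
  | succ m ih => rw [skip_succ]; exact ih

theorem freeDVars_skip {m : ℕ} : (skip m φ).freeDVars = φ.freeDVars := by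
  induction m with
  | zero => rfl
  | succ m ih => simp [skip_succ, freeDVars, ih, BExp.vars]

theorem freeFVars_skip {m : ℕ} : (skip m φ).freeFVars = φ.freeFVars := by
  induction m with
  | zero => rfl
  | succ m ih => simp [skip_succ, freeFVars, ih]

theorem guarded_skip {m : ℕ} : (skip m φ).Guarded ↔ φ.Guarded := by
  induction m with
  | zero => rfl
  | succ m ih => rw [skip_succ]; exact ih

theorem binders_skip {m : ℕ} : (skip m φ).binders = φ.binders := by
  induction m with
  | zero => rfl
  | succ m ih => rw [skip_succ]; exact ih

/-- This makes the recursion in `ev` guarded. The successor matters: `skip 0 φ` is `φ` and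
contributes no modality. -/
theorem unguardedFVars_skip_succ {m : ℕ} : (skip (m + 1) φ).unguardedFVars = ∅ := by
  rw [skip_succ]; rfl

theorem isDisj_readN {s m : ℕ} : (readN s m φ).IsDisj ↔ φ.IsDisj := by
  induction m generalizing s with
  | zero => rfl
  | succ m ih => exact ih

theorem freeFVars_readN {s m : ℕ} : (readN s m φ).freeFVars = φ.freeFVars := by
  induction m generalizing s with
  | zero => rfl
  | succ m ih => exact ih

theorem guarded_readN {s m : ℕ} : (readN s m φ).Guarded ↔ φ.Guarded := by
  induction m generalizing s with
  | zero => rfl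
  | succ m ih => exact ih

theorem binders_readN {s m : ℕ} : (readN s m φ).binders = φ.binders := by
  induction m generalizing s with
  | zero => rfl
  | succ m ih => exact ih

theorem unguardedFVars_readN_succ {s m : ℕ} : (readN s (m + 1) φ).unguardedFVars = ∅ := rfl

theorem mem_freeDVars_readN {s m x : ℕ} (h : x ∈ (readN s m φ).freeDVars) :
    x ∈ φ.freeDVars ∧ ¬ (s ≤ x ∧ x < s + m) := by
  induction m generalizing s with
  | zero => exact ⟨h, by omega⟩
  | succ m ih =>
    simp only [readN, read, freeDVars, BExp.vars, Term.vars, Finset.empty_union,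
      Finset.mem_erase, Finset.mem_union, Finset.mem_singleton] at h
    obtain ⟨h1, h2⟩ := h
    have h3 := ih (h2.resolve_left h1)
    exact ⟨h3.1, by omega⟩

end Formula

/-! ### Computable contexts -/

namespace Formula

theorem primrec_code : Primrec code := Primrec.encode

theorem primrec_of_code {α : Type*} [Primcodable α] {f : α → Formula}
    (h : Primrec fun a => (f a).code) : Primrec f := Primrec.encode_iff.1 h

/-- A primitive recursive function on formulae whose counterpart under dualisation is also
primitive recursive. -/
def IsContext (g : Formula → Formula) : Prop :=
  Primrec g ∧ ∃ g' : Formula → Formula, Primrec g' ∧ ∀ φ, (g φ).dual = g' φ.dual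

/-- Here `r` is the residue that marks the constructor, and `a` is the code of its fixed argument.
-/
theorem primrec_of_code_eq {g : Formula → Formula} (q : ℕ → ℕ → ℕ) (r a : ℕ) (hq : Primrec₂ q)
    (h : ∀ φ, (g φ).code = 9 * q a φ.code + r + 2) : Primrec g := by
  refine primrec_of_code (Primrec.of_eq ?_ fun φ => (h φ).symm)
  exact Primrec.nat_add.comp (Primrec.nat_add.comp (Primrec.nat_mul.comp (Primrec.const 9)
    (hq.comp (Primrec.const a) primrec_code)) (Primrec.const r)) (Primrec.const 2)

theorem IsContext.dia (b : BExp) : IsContext (dia b) :=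
  ⟨primrec_of_code_eq Nat.pair 0 b.code Primrec₂.natPair fun _ => rfl, box b,
    primrec_of_code_eq Nat.pair 1 b.code Primrec₂.natPair fun _ => rfl, fun _ => rfl⟩

theorem IsContext.ex (x : ℕ) : IsContext (ex x) :=
  ⟨primrec_of_code_eq Nat.pair 2 x Primrec₂.natPair fun _ => rfl, all x,
    primrec_of_code_eq Nat.pair 3 x Primrec₂.natPair fun _ => rfl, fun _ => rfl⟩

theorem IsContext.or_right (ψ : Formula) : IsContext (or ψ) :=
  ⟨primrec_of_code_eq Nat.pair 4 ψ.code Primrec₂.natPair fun _ => rfl, and ψ.dual,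
    primrec_of_code_eq Nat.pair 5 ψ.dual.code Primrec₂.natPair fun _ => rfl, fun _ => rfl⟩

theorem IsContext.comp {g h : Formula → Formula} (hg : IsContext g) (hh : IsContext h) :
    IsContext (fun φ => g (h φ)) := by
  obtain ⟨hg, g', hg', eg⟩ := hg
  obtain ⟨hh, h', hh', eh⟩ := hh
  exact ⟨hg.comp hh, fun φ => g' (h' φ), hg'.comp hh', fun φ => by rw [eg, eh]⟩

theorem IsContext.id : IsContext (fun φ => φ) := ⟨Primrec.id, fun φ => φ, Primrec.id, fun _ => rfl⟩

theorem IsContext.skip (m : ℕ) : IsContext (skip m) := by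
  induction m with
  | zero => exact IsContext.id
  | succ m ih =>
    have : Formula.skip (m + 1) = fun φ => Formula.dia BExp.tru (Formula.skip m φ) :=
      funext fun φ => skip_succ m φ
    rw [this]
    exact (IsContext.dia _).comp ih

theorem IsContext.readN (s m : ℕ) : IsContext (readN s m) := by
  induction m generalizing s with
  | zero => exact IsContext.id
  | succ m ih => exact (IsContext.ex s).comp ((IsContext.dia _).comp (ih (s + 1)))

/-- The dual of an iterated context is the iterated dual context applied to the dual start. Hence
the dualised reduction is computable without a recursion for `dual` over all Gödel numbers. -/
theorem IsContext.primrec_iterate {g h : Formula → Formula} (hg : IsContext g) (hh : IsContext h)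
    (φ : Formula) : Primrec (fun n : ℕ => g (h^[n] φ)) ∧
      Primrec (fun n : ℕ => (g (h^[n] φ)).dual) := by
  obtain ⟨hg, g', hg', eg⟩ := hg
  obtain ⟨hh, h', hh', eh⟩ := hh
  refine ⟨hg.comp (Primrec.nat_iterate Primrec.id (Primrec.const φ) (hh.comp Primrec.snd)), ?_⟩
  refine (hg'.comp (Primrec.nat_iterate (f := fun n : ℕ => n) (g := fun _ => φ.dual)
    (h := fun _ => h') Primrec.id (Primrec.const _) (hh'.comp Primrec.snd))).of_eq fun n => ?_
  rw [eg]
  congr 1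
  induction n with
  | zero => rfl
  | succ n ih => rw [Function.iterate_succ_apply', Function.iterate_succ_apply', eh, ih]

end Formula

end RecHMLd

namespace RecHMLd

/-! ### Log machines

A log machine writes an infinite log of records. A record consists of a tag and three pointers to
records of the log. Each new record is determined by the last record and by one earlier record, to
which one of the pointers of the last record refers. -/

/-- The pointer fields of a record. -/
inductive Ptr : Type
  | k | v | u

/-- The sources of a pointer in a new record: a field of the last record, a field of the record that
was looked up, the last record itself, and the first record of the log. -/
inductive Src : Type
  | cur : Ptr → Src
  | old : Ptr → Src
  | self : Src
  | zero : Src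

/-- The records of a log. -/
structure Rec (Tag : Type) where
  tag : Tag
  ptr : Ptr → ℕ

/-- The pointer that a source stands for, if `y` is the last record, with index `j`, and `x` is the
record that was looked up. -/
def Src.val {Tag : Type} (j : ℕ) (x y : Rec Tag) : Src → ℕ
  | .cur p => y.ptr p
  | .old p => x.ptr p
  | .self => j
  | .zero => 0

/-- Log machines. The records after the first one have the tag `inp` as often as the input says, then
there is one record with the tag `start`. -/
structure LogMachine (Tag : Type) where
  nil : Tag
  inp : Tag
  start : Tag
  look : Tag → Ptr
  -- The outer `none` means stuck. The inner `none` leaves the tag to the input, so that `act` does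
  -- not depend on `n`.
  act : Tag → Tag → Option (Option Tag × (Ptr → Src))
  start_ne : start ≠ nil ∧ start ≠ inp
  -- The input records are chained through `u`: record `j ≤ n` is the unary numeral of `j`, and the
  -- start record points to the numeral of `n`.
  act_input : ∀ T S, T = nil ∨ T = inp →
    ∃ s, act T S = some (none, s) ∧ s .k = .zero ∧ s .v = .zero ∧ s .u = .self
  act_not_input : ∀ T S o s, ¬ (T = nil ∨ T = inp) → act T S = some (o, s) →
    ∃ T', o = some T' ∧ ¬ (T' = nil ∨ T' = inp)

namespace LogMachine

variable {Tag : Type} (M : LogMachine Tag)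

/-- The first record. -/
def init : Rec Tag := ⟨M.nil, fun _ => 0⟩

/-- The tag of record `j` on input `n`, for `j ≤ n + 1`. -/
def inputTag (n : ℕ) : ℕ → Tag
  | 0 => M.nil
  | j + 1 => if j + 1 ≤ n then M.inp else M.start

/-- The record after `y`, which has the index `j`. -/
def next (n j : ℕ) (x y : Rec Tag) : Rec Tag :=
  match M.act y.tag x.tag with
  -- The default tag avoids `nil` and `inp`, so `tag_log_of_gt` holds beyond a stuck record too.
  | none => ⟨M.start, fun _ => 0⟩
  | some (o, s) => ⟨o.getD (M.inputTag n (j + 1)), fun p => (s p).val j x y⟩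

/-- The log on input `n`. After the machine got stuck it is irrelevant. -/
def log (n : ℕ) : ℕ → Rec Tag
  | 0 => M.init
  -- The `min` only secures termination; `log_succ` removes it.
  | j + 1 => M.next n j (log n (min j ((log n j).ptr (M.look (log n j).tag)))) (log n j)
termination_by j => j
decreasing_by all_goals omega

/-- The index of the record that record `j` looks up. -/
def lookup (n j : ℕ) : ℕ := (M.log n j).ptr (M.look (M.log n j).tag)

theorem log_zero (n : ℕ) : M.log n 0 = M.init := by rw [log]

theorem log_succ' (n j : ℕ) :
    M.log n (j + 1) = M.next n j (M.log n (min j (M.lookup n j))) (M.log n j) := by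
  rw [log]; rfl

/-- A source is an older pointer, the last record or record 0, so pointers go strictly backwards.
The `max` accounts for record 0, which points to itself. -/
theorem ptr_log_lt (n j : ℕ) (p : Ptr) : (M.log n j).ptr p < max j 1 := by
  induction j using Nat.strong_induction_on generalizing p with
  | _ j ih =>
    cases j with
    | zero => simp [log_zero, init]
    | succ j =>
      rw [log_succ', next]
      split
      · simp
      · rename_i o s _
        cases hs : s p with
        | cur q =>
          have := ih j (by omega) q
          simp only [hs, Src.val]; omega
        | old q =>
          have := ih (min j (M.lookup n j)) (by omega) q
          simp only [hs, Src.val]; omega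
        | self => simp [hs, Src.val]
        | zero => simp [hs, Src.val]

theorem lookup_lt (n j : ℕ) : M.lookup n j < max j 1 := M.ptr_log_lt n j _

theorem log_succ (n j : ℕ) :
    M.log n (j + 1) = M.next n j (M.log n (M.lookup n j)) (M.log n j) := by
  have := M.lookup_lt n j
  rw [log_succ', min_eq_right (by omega)]

/-- What the machine does after record `j`; `none` means that it is stuck. -/
def action (n j : ℕ) : Option (Option Tag × (Ptr → Src)) :=
  M.act (M.log n j).tag (M.log n (M.lookup n j)).tag

theorem log_succ_of_action {n j : ℕ} {o : Option Tag} {s : Ptr → Src}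
    (h : M.action n j = some (o, s)) :
    M.log n (j + 1) = ⟨o.getD (M.inputTag n (j + 1)),
      fun p => (s p).val j (M.log n (M.lookup n j)) (M.log n j)⟩ := by
  rw [log_succ, next]
  rw [action] at h
  simp [h]

theorem inputTag_of_le {n j : ℕ} (h : j ≤ n) : M.inputTag n j = M.nil ∨ M.inputTag n j = M.inp := by
  cases j with
  | zero => exact Or.inl rfl
  | succ j => right; simp [inputTag, h]

theorem tag_log_of_le {n j : ℕ} (h : j ≤ n + 1) : (M.log n j).tag = M.inputTag n j := by
  induction j with
  | zero => rw [log_zero]; rfl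
  | succ j ih =>
    have hj := ih (by omega)
    obtain ⟨s, hs, -⟩ := M.act_input (M.log n j).tag (M.log n (M.lookup n j)).tag
      (hj ▸ M.inputTag_of_le (by omega))
    rw [M.log_succ_of_action hs]
    rfl

theorem inputTag_succ_self (n : ℕ) : M.inputTag n (n + 1) = M.start := by simp [inputTag]

/-- After the input the action names every tag explicitly, so a test that does not know `n` can
check it. -/
theorem tag_log_of_gt {n j : ℕ} (h : n < j) :
    ¬ ((M.log n j).tag = M.nil ∨ (M.log n j).tag = M.inp) := by
  induction j, h using Nat.le_induction with
  | base =>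
    rw [tag_log_of_le _ le_rfl, inputTag_succ_self]
    exact not_or.2 M.start_ne
  | succ j hj ih =>
    rcases ha : M.action n j with _ | ⟨o, s⟩
    · rw [log_succ, next]
      rw [action] at ha
      simp only [ha]
      exact not_or.2 M.start_ne
    · obtain ⟨T', rfl, hT'⟩ := M.act_not_input _ _ _ _ ih ha
      rw [M.log_succ_of_action ha]
      exact hT'

theorem log_input {n j : ℕ} (h : j ≤ n) :
    (M.log n (j + 1)).ptr .k = 0 ∧ (M.log n (j + 1)).ptr .v = 0 ∧ (M.log n (j + 1)).ptr .u = j := by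
  obtain ⟨s, hs, hk, hv, hu⟩ := M.act_input (M.log n j).tag (M.log n (M.lookup n j)).tag
    (tag_log_of_le M (show j ≤ n + 1 by omega) ▸ M.inputTag_of_le h)
  rw [M.log_succ_of_action hs]
  simp [hk, hv, hu, Src.val]

end LogMachine

/-! ### Logs as traces

A trace starts with the identity of record 0 and the letters for the tags. Then it lists the records
of a log in blocks of five values: the letter for the tag, the identity of the record, and the
identities of the records to which its pointers refer. The data variables `0, …, 4` hold an earlier
block, `5, …, 14` hold a block and its successor, `15` holds the identity of record 0, and the
following ones the letters for the tags. -/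

/-- The offset of a pointer field. -/
def Ptr.idx : Ptr → ℕ
  | .k => 0
  | .v => 1
  | .u => 2

theorem Ptr.idx_lt (p : Ptr) : p.idx < 3 := by cases p <;> decide

/-- The data variable that holds a source. -/
def Src.var : Src → ℕ
  | .cur p => 7 + p.idx
  | .old p => 2 + p.idx
  | .self => 6
  | .zero => 15

theorem Src.var_lt (s : Src) : s.var < 16 := by
  cases s with
  | cur p => have := p.idx_lt; simp only [Src.var]; omega
  | old p => have := p.idx_lt; simp only [Src.var]; omega
  | self => decide
  | zero => decide

section Trace

variable {D : Type*}

/-- Entry `f` of block `j`. -/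
def entry (t : Trace D) (j f : ℕ) : D := t (5 * j + f)

/-- The identity of the record that a source stands for. -/
def Src.deref (z : D) (t : Trace D) (i j : ℕ) : Src → D
  | .cur p => entry t j (2 + p.idx)
  | .old p => entry t i (2 + p.idx)
  | .self => entry t j 1
  | .zero => z

variable {Tag : Type} (M : LogMachine Tag)

/-- The trace `t` contains an error at the blocks `i`, `j` and `j + 1`. -/
def LogMachine.ErrorAt (z : D) (a : Tag → D) (t : Trace D) (i j : ℕ) : Prop :=
  (∃ T S, T ≠ S ∧ a T = a S) ∨ entry t i 1 = entry t j 1 ∨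
    ∃ T S, entry t j 0 = a T ∧ entry t i 0 = a S ∧ entry t i 1 = entry t j (2 + (M.look T).idx) ∧
      -- If the machine is stuck this is vacuous, so whatever follows counts as an error. An inner
      -- `none` puts no demand on the tag.
      ∀ o s, M.act T S = some (o, s) → (∃ T', o = some T' ∧ entry t (j + 1) 0 ≠ a T') ∨
        ∃ p, entry t (j + 1) (2 + p.idx) ≠ (s p).deref z t i j

/-- The trace `t` contains an error in the blocks `0, …, n + 1`. -/
def LogMachine.InputError (z : D) (a : Tag → D) (n : ℕ) (t : Trace D) : Prop :=
  (∃ j ≤ n + 1, entry t j 0 ≠ a (M.inputTag n j)) ∨ entry t 0 1 ≠ z ∨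
    -- Block 1 is included because `ErrorAt` is applied with `i < j` only and so never checks the
    -- successor of block 0.
    (∃ p : Ptr, entry t 0 (2 + p.idx) ≠ z) ∨ (∃ p : Ptr, entry t 1 (2 + p.idx) ≠ z)

variable {M}

/-- In a trace without errors the blocks are the records of the log. -/
theorem LogMachine.entry_eq_of_no_error {z : D} {a : Tag → D} {n : ℕ} {t : Trace D}
    (hI : ¬ M.InputError z a n t) (hE : ∀ i j, i < j → ¬ M.ErrorAt z a t i j) (j : ℕ) :
    entry t j 0 = a (M.log n j).tag ∧
      ∀ p : Ptr, entry t j (2 + p.idx) = entry t ((M.log n j).ptr p) 1 := by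
  simp only [InputError, not_or, not_exists, not_and, not_not] at hI
  obtain ⟨hI, h0, h1, h2⟩ := hI
  -- Block `j + 1` and the block that it looks up are already known to agree with the log; the
  -- absence of an error at this pair forces block `j + 2`. Values that happen to coincide only make
  -- further tests apply.
  induction j using Nat.strong_induction_on with
  | _ j ih =>
    match j with
    | 0 =>
      rw [log_zero]
      exact ⟨hI 0 (by omega), fun p => (h1 p).trans h0.symm⟩
    | 1 =>
      refine ⟨by rw [tag_log_of_le _ (by omega)]; exact hI 1 (by omega), fun p => ?_⟩
      have : (M.log n (0 + 1)).ptr p = 0 := by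
        have := M.log_input (n := n) (Nat.zero_le n)
        cases p <;> simp [this]
      rw [h2, this, h0]
    | j + 2 =>
      obtain ⟨hj1, hj2⟩ := ih (j + 1) (by omega)
      have hl := M.lookup_lt n (j + 1)
      obtain ⟨hi1, hi2⟩ := ih (M.lookup n (j + 1)) (by omega)
      have h := hE (M.lookup n (j + 1)) (j + 1) (by omega)
      simp only [ErrorAt, not_or, not_exists, not_and] at h
      obtain ⟨-, -, h⟩ := h
      have h := h _ _ hj1 hi1 (hj2 _).symm
      push Not at h
      obtain ⟨o, s, ha, h3, h4⟩ := h
      have ha' : M.action n (j + 1) = some (o, s) := ha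
      rw [M.log_succ_of_action ha']
      constructor
      -- Tags up to index `n + 1` are controlled by the input test, later ones by the action.
      · by_cases hjn : j + 2 ≤ n + 1
        · have : j + 1 ≤ n := by omega
          obtain ⟨s', hs', -⟩ := M.act_input (M.log n (j + 1)).tag
            (M.log n (M.lookup n (j + 1))).tag
            (tag_log_of_le M (show j + 1 ≤ n + 1 by omega) ▸ M.inputTag_of_le this)
          rw [ha] at hs'
          cases hs'
          exact hI _ hjn
        · obtain ⟨T', rfl, -⟩ := M.act_not_input _ _ _ _ (M.tag_log_of_gt (by omega)) ha
          exact h3 T' rfl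
      · intro p
        rw [h4]
        cases hs : s p with
        | cur q => simp only [hs]; exact hj2 q
        | old q => simp only [hs]; exact hi2 q
        | self => simp only [hs]; rfl
        | zero => simp only [hs]; exact h0.symm

/-- A trace without errors shows that the machine is never stuck. -/
theorem LogMachine.action_ne_none_of_no_error {z : D} {a : Tag → D} {n : ℕ} {t : Trace D}
    (hI : ¬ M.InputError z a n t) (hE : ∀ i j, i < j → ¬ M.ErrorAt z a t i j) (j : ℕ) :
    M.action n (j + 1) ≠ none := by
  intro ha
  have hl := M.lookup_lt n (j + 1)
  obtain ⟨hj1, hj2⟩ := entry_eq_of_no_error hI hE (j + 1)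
  obtain ⟨hi1, hi2⟩ := entry_eq_of_no_error hI hE (M.lookup n (j + 1))
  refine hE (M.lookup n (j + 1)) (j + 1) (by omega) (Or.inr (Or.inr ⟨_, _, hj1, hi1, (hj2 _).symm, ?_⟩))
  intro o s hs
  rw [action] at ha
  rw [ha] at hs
  cases hs

variable (M) in
/-- The log as a trace, if the tags have the letters `a` and the records have the identities `d`. -/
def LogMachine.trace (a : Tag → D) (d : ℕ → D) (n : ℕ) : Trace D := fun m =>
  match m % 5 with
  | 0 => a (M.log n (m / 5)).tag
  | 1 => d (m / 5)
  | 2 => d ((M.log n (m / 5)).ptr .k)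
  | 3 => d ((M.log n (m / 5)).ptr .v)
  | _ => d ((M.log n (m / 5)).ptr .u)

section

variable {a : Tag → D} {d : ℕ → D} {n j : ℕ}

theorem LogMachine.entry_trace_zero : entry (M.trace a d n) j 0 = a (M.log n j).tag := by
  have h1 : (5 * j + 0) % 5 = 0 := by omega
  have h2 : (5 * j + 0) / 5 = j := by omega
  simp only [entry, trace, h1, h2]

theorem LogMachine.entry_trace_one : entry (M.trace a d n) j 1 = d j := by
  have h1 : (5 * j + 1) % 5 = 1 := by omega
  have h2 : (5 * j + 1) / 5 = j := by omega
  simp only [entry, trace, h1, h2]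

theorem LogMachine.entry_trace_ptr (p : Ptr) :
    entry (M.trace a d n) j (2 + p.idx) = d ((M.log n j).ptr p) := by
  have h1 : (5 * j + (2 + p.idx)) % 5 = 2 + p.idx := by have := p.idx_lt; omega
  have h2 : (5 * j + (2 + p.idx)) / 5 = j := by have := p.idx_lt; omega
  simp only [entry, trace, h1, h2]
  cases p <;> rfl

end

theorem LogMachine.not_inputError_trace (a : Tag → D) (d : ℕ → D) (n : ℕ) :
    ¬ M.InputError (d 0) a n (M.trace a d n) := by
  simp only [InputError, not_or, not_exists, not_and, not_not, entry_trace_zero, entry_trace_one,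
    entry_trace_ptr]
  refine ⟨fun j hj => by rw [tag_log_of_le _ hj], trivial, fun p => ?_, fun p => ?_⟩
  · rw [log_zero]; rfl
  · have h := M.log_input (n := n) (Nat.zero_le n)
    rw [zero_add] at h
    cases p <;> simp [h]

/-- Injectivity forces the matched `T` and `S` to be the actual tags and `i` to be the actual
lookup, so the only demand on the next block is the one by which the log is defined. -/
theorem LogMachine.not_errorAt_trace {a : Tag → D} {d : ℕ → D} (ha : a.Injective) (hd : d.Injective)
    {n : ℕ} (h : ∀ j, M.action n (j + 1) ≠ none) {i j : ℕ} (hij : i < j) :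
    ¬ M.ErrorAt (d 0) a (M.trace a d n) i j := by
  simp only [ErrorAt, entry_trace_zero, entry_trace_one, entry_trace_ptr]
  rintro (⟨T, S, hTS, e⟩ | e | ⟨T, S, hT, hS, e, he⟩)
  · exact hTS (ha e)
  · exact hij.ne (hd e)
  · cases ha hT
    cases ha hS
    have hi : i = M.lookup n j := hd e
    subst hi
    obtain ⟨j, rfl⟩ : ∃ j', j = j' + 1 := ⟨j - 1, by omega⟩
    rcases hact : M.action n (j + 1) with _ | ⟨o, s⟩
    · exact h j hact
    · rw [M.log_succ_of_action hact] at he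
      rcases he o s hact with ⟨T', rfl, hne⟩ | ⟨p, hne⟩
      · exact hne rfl
      · refine hne ?_
        cases hs : s p <;> simp [Src.deref, Src.val, entry_trace_one, entry_trace_ptr, hs]

variable (M) in
-- This is the form in which the formula tests the input. Positions 1 to 4 are the identity and
-- pointers of block 0, and 7 to 9 the pointers of block 1; position 6, the identity of block 1, is
-- free.
theorem LogMachine.inputError_iff {z : D} {a : Tag → D} {n : ℕ} : M.InputError z a n t ↔
    (∃ m ∈ [1, 2, 3, 4, 7, 8, 9], t m ≠ z) ∨ t 0 ≠ a M.nil ∨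
      (∃ j < n, entry (shift 5 t) j 0 ≠ a M.inp) ∨ entry (shift 5 t) n 0 ≠ a M.start := by
  have hp : ∀ q : Ptr → Prop, (∃ p, q p) ↔ q .k ∨ q .v ∨ q .u := fun q =>
    ⟨by rintro ⟨p, h⟩; cases p <;> simp [h], by rintro (h | h | h) <;> exact ⟨_, h⟩⟩
  have h : ∀ j, entry (shift 5 t) j 0 = entry t (j + 1) 0 := fun j => by
    simp only [entry, shift]
    congr 1
    omega
  have htag : (∃ j ≤ n + 1, entry t j 0 ≠ a (M.inputTag n j)) ↔ t 0 ≠ a M.nil ∨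
      (∃ j < n, entry t (j + 1) 0 ≠ a M.inp) ∨ entry t (n + 1) 0 ≠ a M.start := by
    constructor
    · rintro ⟨j, hj, H⟩
      rcases j with _ | j
      · exact Or.inl H
      · rcases Nat.lt_or_ge j n with hjn | hjn
        · rw [inputTag, if_pos (by omega)] at H
          exact Or.inr (Or.inl ⟨j, hjn, H⟩)
        · obtain rfl : j = n := by omega
          rw [inputTag, if_neg (by omega)] at H
          exact Or.inr (Or.inr H)
    · rintro (H | ⟨j, hj, H⟩ | H)
      · exact ⟨0, by omega, H⟩
      · exact ⟨j + 1, by omega, by rwa [inputTag, if_pos (by omega)]⟩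
      · exact ⟨n + 1, le_rfl, by rwa [inputTag_succ_self]⟩
  simp only [h, InputError, htag, hp]
  simp only [entry, Ptr.idx, List.mem_cons, List.not_mem_nil, or_false, exists_eq_or_imp,
    exists_eq_left, mul_zero, mul_one, zero_add, Nat.reduceAdd]
  rw [or_comm]
  simp only [or_assoc]

end Trace

end RecHMLd

namespace RecHMLd

/-! ### The formula of a log machine -/

namespace LogMachine

open Formula

variable {Tag : Type} [Fintype Tag]

/-- The data variable that holds the letter for a tag. -/
noncomputable def letter (T : Tag) : ℕ := 16 + (Fintype.equivFin Tag T : ℕ)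

theorem letter_lt (T : Tag) : letter T < 16 + Fintype.card Tag := by
  have := (Fintype.equivFin Tag T).isLt
  simp only [letter]; omega

variable (M : LogMachine Tag)

/-- The new record is not the one that the machine prescribes. -/
noncomputable def actionConstraint : Option (Option Tag × (Ptr → Src)) → BExp
  | none => .tru
  | some (o, s) => .any (o.toList.map (fun T => .neg (.eqv 10 (letter T))) ++
      [Ptr.k, Ptr.v, Ptr.u].map fun p => .neg (.eqv (12 + p.idx) (s p).var))

/-- The error that a machine makes after a record with the tag `T` if it looks up a record with the
tag `S`. -/
noncomputable def stepConstraint (T S : Tag) : BExp :=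
  .and (.eqv 5 (letter T)) (.and (.eqv 0 (letter S))
    (.and (.eqv 1 (7 + (M.look T).idx)) (actionConstraint (M.act T S))))

open Classical in
/-- There is an error at the blocks in the data variables. -/
noncomputable def errorConstraint : BExp :=
  .any (.eqv 1 6 :: (Finset.univ : Finset (Tag × Tag)).toList.map fun p =>
    if p.1 = p.2 then M.stepConstraint p.1 p.2 else
      .any [.eqv (letter p.1) (letter p.2), M.stepConstraint p.1 p.2])

section

variable {D : Type*} {δ : DEnv D} {e : D}

theorem holds_actionConstraint {x : Option (Option Tag × (Ptr → Src))} :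
    (actionConstraint x).Holds δ e ↔ ∀ o s, x = some (o, s) →
      (∃ T, o = some T ∧ δ 10 ≠ δ (letter T)) ∨ ∃ p : Ptr, δ (12 + p.idx) ≠ δ (s p).var := by
  rcases x with _ | ⟨o, s⟩
  · simp [actionConstraint, BExp.Holds]
  · have h : (∃ p : Ptr, δ (12 + p.idx) ≠ δ (s p).var) ↔
        ∃ p ∈ [Ptr.k, Ptr.v, Ptr.u], δ (12 + p.idx) ≠ δ (s p).var :=
      exists_congr fun p => by cases p <;> simp
    constructor
    · intro H o' s' e'
      cases e'
      rw [h]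
      rw [actionConstraint, BExp.holds_any] at H
      obtain ⟨b, hb, H⟩ := H
      rcases List.mem_append.1 hb with hb | hb
      · obtain ⟨T, hT, rfl⟩ := List.mem_map.1 hb
        exact Or.inl ⟨T, by simpa using hT, H⟩
      · obtain ⟨p, hp, rfl⟩ := List.mem_map.1 hb
        exact Or.inr ⟨p, hp, H⟩
    · intro H
      rw [actionConstraint, BExp.holds_any]
      specialize H o s rfl
      rw [h] at H
      rcases H with ⟨T, hT, H⟩ | ⟨p, hp, H⟩
      · exact ⟨_, List.mem_append_left _ (List.mem_map.2 ⟨T, by simp [hT], rfl⟩), H⟩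
      · exact ⟨_, List.mem_append_right _ (List.mem_map.2 ⟨p, hp, rfl⟩), H⟩

theorem holds_errorConstraint : M.errorConstraint.Holds δ e ↔
    (∃ T S : Tag, T ≠ S ∧ δ (letter T) = δ (letter S)) ∨ δ 1 = δ 6 ∨
      ∃ T S, δ 5 = δ (letter T) ∧ δ 0 = δ (letter S) ∧ δ 1 = δ (7 + (M.look T).idx) ∧
        (actionConstraint (M.act T S)).Holds δ e := by
  have hstep : ∀ T S, (M.stepConstraint T S).Holds δ e ↔ δ 5 = δ (letter T) ∧ δ 0 = δ (letter S) ∧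
      δ 1 = δ (7 + (M.look T).idx) ∧ (actionConstraint (M.act T S)).Holds δ e := fun _ _ => Iff.rfl
  simp only [← hstep]
  rw [errorConstraint, BExp.holds_any]
  constructor
  · rintro ⟨b, hb, H⟩
    rcases List.mem_cons.1 hb with rfl | hb
    · exact Or.inr (Or.inl H)
    · obtain ⟨⟨T, S⟩, -, rfl⟩ := List.mem_map.1 hb
      split_ifs at H with hTS
      · exact Or.inr (Or.inr ⟨_, _, H⟩)
      · rw [BExp.holds_any] at H
        obtain ⟨b, hb, H⟩ := H
        simp only [List.mem_cons, List.not_mem_nil, or_false] at hb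
        rcases hb with rfl | rfl
        · exact Or.inl ⟨T, S, hTS, H⟩
        · exact Or.inr (Or.inr ⟨_, _, H⟩)
  · rintro (⟨T, S, hTS, H⟩ | H | ⟨T, S, H⟩)
    · refine ⟨_, List.mem_cons_of_mem _ (List.mem_map.2 ⟨(T, S), by simp, rfl⟩), ?_⟩
      simp only [if_neg hTS]
      rw [BExp.holds_any]
      exact ⟨_, List.mem_cons_self, H⟩
    · exact ⟨_, List.mem_cons_self, H⟩
    · refine ⟨_, List.mem_cons_of_mem _ (List.mem_map.2 ⟨(T, S), by simp, rfl⟩), ?_⟩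
      dsimp only
      split_ifs with hTS
      · exact H
      · rw [BExp.holds_any]
        exact ⟨_, List.mem_cons_of_mem _ List.mem_cons_self, H⟩

theorem holds_errorConstraint_iff_errorAt {t : Trace D} {i j : ℕ}
    (hx : ∀ f < 5, δ f = entry t i f) (hy : ∀ f < 5, δ (5 + f) = entry t j f)
    (hz : ∀ f < 5, δ (10 + f) = entry t (j + 1) f) :
    M.errorConstraint.Holds δ e ↔ M.ErrorAt (δ 15) (fun T => δ (letter T)) t i j := by
  have h10 : δ 10 = entry t (j + 1) 0 := hz 0 (by omega)
  have h5 : δ 5 = entry t j 0 := hy 0 (by omega)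
  have h6 : δ 6 = entry t j 1 := hy 1 (by omega)
  have h7 : ∀ p : Ptr, δ (7 + p.idx) = entry t j (2 + p.idx) := fun p => by
    rw [← hy _ (by have := p.idx_lt; omega)]
    congr 1
    omega
  have h12 : ∀ p : Ptr, δ (12 + p.idx) = entry t (j + 1) (2 + p.idx) := fun p => by
    rw [← hz _ (by have := p.idx_lt; omega)]
    congr 1
    omega
  have hs : ∀ s : Src, δ s.var = s.deref (δ 15) t i j := by
    intro s
    cases s with
    | cur p => exact h7 p
    | old p => exact hx (2 + p.idx) (by have := p.idx_lt; omega)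
    | self => exact h6
    | zero => rfl
  rw [holds_errorConstraint]
  simp only [ErrorAt, holds_actionConstraint, hx 1 (by omega), hx 0 (by omega), h5, h6, h7, h12, h10,
    hs]

end

theorem vars_errorConstraint : M.errorConstraint.vars ⊆ Finset.range (16 + Fintype.card Tag) := by
  have hl : ∀ T : Tag, letter T ∈ Finset.range (16 + Fintype.card Tag) := fun T =>
    Finset.mem_range.2 (letter_lt T)
  have hn : ∀ m < 16, m ∈ Finset.range (16 + Fintype.card Tag) := fun m hm =>
    Finset.mem_range.2 (by omega)
  have hact : ∀ x : Option (Option Tag × (Ptr → Src)),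
      (actionConstraint x).vars ⊆ Finset.range (16 + Fintype.card Tag) := by
    rintro (_ | ⟨o, s⟩)
    · simp [actionConstraint, BExp.vars]
    · refine BExp.vars_any_subset fun b hb => ?_
      rcases List.mem_append.1 hb with hb | hb
      · obtain ⟨T, -, rfl⟩ := List.mem_map.1 hb
        exact BExp.vars_eqv_subset (hn _ (by omega)) (hl T)
      · obtain ⟨p, -, rfl⟩ := List.mem_map.1 hb
        exact BExp.vars_eqv_subset (hn _ (by have := p.idx_lt; omega)) (hn _ (s p).var_lt)
  have hstep : ∀ T S, (M.stepConstraint T S).vars ⊆ Finset.range (16 + Fintype.card Tag) :=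
    fun T S => Finset.union_subset (BExp.vars_eqv_subset (hn _ (by omega)) (hl T))
      (Finset.union_subset (BExp.vars_eqv_subset (hn _ (by omega)) (hl S))
        (Finset.union_subset (BExp.vars_eqv_subset (hn _ (by omega))
          (hn _ (by have := (M.look T).idx_lt; omega))) (hact _)))
  refine BExp.vars_any_subset fun b hb => ?_
  rcases List.mem_cons.1 hb with rfl | hb
  · exact BExp.vars_eqv_subset (hn _ (by omega)) (hn _ (by omega))
  · obtain ⟨⟨T, S⟩, -, rfl⟩ := List.mem_map.1 hb
    dsimp only
    split_ifs
    · exact hstep T S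
    · refine BExp.vars_any_subset fun c hc => ?_
      simp only [List.mem_cons, List.not_mem_nil, or_false] at hc
      rcases hc with rfl | rfl
      · exact BExp.vars_eqv_subset (hl T) (hl S)
      · exact hstep T S

/-- The current value differs from that of the variable `x`. -/
def _root_.RecHMLd.Formula.differs (x : ℕ) : Formula := dia (.neg (.eq .star (.dvar x))) tt

/-- There is an error at a block, and at a later block and its successor. -/
noncomputable def errorFormula : Formula :=
  -- The outer `ev` guesses `i`; the inner one starts behind block `i`, which yields `j > i`. The
  -- last diamond consumes a value merely because constraints occur on modalities only.
  ev 0 5 (readN 0 5 (ev 1 5 (readN 5 10 (dia M.errorConstraint tt))))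

/-- There is an error in the first two blocks, except for the tags, or `φ` holds. -/
def pointerErrorFormula (φ : Formula) : Formula :=
  [1, 2, 3, 4, 7, 8, 9].foldr (fun m ψ => or (skip m (differs 15)) ψ) φ

/-- The block has a tag other than `T`, or `φ` holds after it. -/
noncomputable def tagErrorFormula (T : Tag) (φ : Formula) : Formula :=
  or (differs (letter T)) (skip 5 φ)

/-- The formula that holds for the traces that are not the log on input `n`. -/
noncomputable def formula (n : ℕ) : Formula :=
  -- Formulae have no data constants, so the trace itself announces the identity of record 0 and the
  -- letters. Only the number of iterations depends on `n`.
  readN 15 (Fintype.card Tag + 1) (or M.errorFormula (pointerErrorFormula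
    (tagErrorFormula M.nil ((tagErrorFormula M.inp)^[n] (differs (letter M.start))))))

/-! ### Semantics of the formula -/

section

variable {D : Type*} {ρ : TEnv D} {δ : DEnv D} {t : Trace D}

theorem mem_sem_differs {x : ℕ} : t ∈ (differs x).sem ρ δ ↔ t 0 ≠ δ x := by
  simp [differs, sem, BExp.Holds, Term.val]

theorem mem_sem_errorFormula : t ∈ M.errorFormula.sem ρ δ ↔
    ∃ i j, i < j ∧ M.ErrorAt (δ 15) (fun T => δ (letter T)) t i j := by
  have h1 : ∀ (ρ : TEnv D) δ, (readN 5 10 (dia M.errorConstraint tt)).sem ρ δ =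
      {t | M.errorConstraint.Holds (store 5 10 t δ) (shift 10 t 0)} := by
    intro ρ δ
    ext t
    rw [mem_sem_readN]
    simp [sem]
  have h2 : ∀ (ρ : TEnv D) δ, (readN 0 5 (ev 1 5 (readN 5 10 (dia M.errorConstraint tt)))).sem ρ δ =
      {t | ∃ k, M.errorConstraint.Holds (store 5 10 (shift (5 * k) (shift 5 t)) (store 0 5 t δ))
        (shift 10 (shift (5 * k) (shift 5 t)) 0)} := by
    intro ρ δ
    ext t
    rw [mem_sem_readN, mem_sem_ev h1]
    simp only [h1]
    rfl
  rw [errorFormula, mem_sem_ev h2]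
  simp only [h2, Set.mem_ofPred_eq, shift_shift]
  -- With `j = i + 1 + k` the offset `5 * i + (5 + 5 * k)` is `5 * j`. Neither `store` touches the
  -- variables from 15 on.
  have h3 : ∀ i k, M.errorConstraint.Holds
      (store 5 10 (shift (5 * i + (5 + 5 * k)) t) (store 0 5 (shift (5 * i) t) δ))
      (shift (5 * i + (5 + 5 * k + 10)) t 0) ↔
        M.ErrorAt (δ 15) (fun T => δ (letter T)) t i (i + 1 + k) := by
    intro i k
    rw [holds_errorConstraint_iff_errorAt (t := t) (i := i) (j := i + 1 + k)]
    · have h : ∀ x, 15 ≤ x →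
          store 5 10 (shift (5 * i + (5 + 5 * k)) t) (store 0 5 (shift (5 * i) t) δ) x = δ x := by
        intro x hx
        rw [store, if_neg (by omega), store, if_neg (by omega)]
      have hl : ∀ T : Tag, 15 ≤ letter T := fun T => by simp only [letter]; omega
      rw [h 15 le_rfl]
      simp only [h _ (hl _)]
    · intro f hf
      rw [store, if_neg (by omega), store, if_pos (by omega)]
      rfl
    · intro f hf
      rw [store, if_pos (by omega), shift, entry]
      congr 1
      omega
    · intro f hf
      rw [store, if_pos (by omega), shift, entry]
      congr 1
      omega
  constructor
  · rintro ⟨i, k, h⟩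
    exact ⟨i, i + 1 + k, by omega, (h3 i k).1 h⟩
  · rintro ⟨i, j, hij, h⟩
    obtain ⟨k, rfl⟩ : ∃ k, j = i + 1 + k := ⟨j - (i + 1), by omega⟩
    exact ⟨i, k, (h3 i k).2 h⟩

theorem mem_sem_foldr_differs {l : List ℕ} {x : ℕ} {φ : Formula} :
    t ∈ (l.foldr (fun m ψ => or (skip m (differs x)) ψ) φ).sem ρ δ ↔
      (∃ m ∈ l, t m ≠ δ x) ∨ t ∈ φ.sem ρ δ := by
  induction l with
  | nil => simp
  | cons m l ih =>
    rw [List.foldr_cons, sem, Set.mem_union, ih, mem_sem_skip, mem_sem_differs, ← or_assoc]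
    simp [shift]

theorem mem_sem_tagErrorFormula {T : Tag} {φ : Formula} :
    t ∈ (tagErrorFormula T φ).sem ρ δ ↔ t 0 ≠ δ (letter T) ∨ shift 5 t ∈ φ.sem ρ δ := by
  rw [tagErrorFormula, sem, Set.mem_union, mem_sem_differs, mem_sem_skip]

theorem mem_sem_iterate_tagErrorFormula {T S : Tag} {n : ℕ} :
    t ∈ ((tagErrorFormula T)^[n] (differs (letter S))).sem ρ δ ↔
      (∃ j < n, entry t j 0 ≠ δ (letter T)) ∨ entry t n 0 ≠ δ (letter S) := by
  induction n generalizing t with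
  | zero => simp [mem_sem_differs, entry]
  | succ n ih =>
    have h : ∀ j, entry (shift 5 t) j 0 = entry t (j + 1) 0 := fun j => by
      simp only [entry, shift]
      congr 1
      omega
    rw [Function.iterate_succ_apply', mem_sem_tagErrorFormula, ih, Nat.exists_lt_succ_left]
    simp only [h]
    rw [or_assoc]
    rfl

theorem mem_sem_formula {n : ℕ} : t ∈ (M.formula n).sem ρ δ ↔
    (∃ i j, i < j ∧ M.ErrorAt (t 0) (fun T => t (letter T - 15))
      (shift (Fintype.card Tag + 1) t) i j) ∨
    M.InputError (t 0) (fun T => t (letter T - 15)) n (shift (Fintype.card Tag + 1) t) := by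
  have h0 : store 15 (Fintype.card Tag + 1) t δ 15 = t 0 := by
    rw [store, if_pos (by omega)]
  have hl : ∀ T : Tag, store 15 (Fintype.card Tag + 1) t δ (letter T) = t (letter T - 15) :=
    fun T => by
      have := letter_lt T
      rw [store, if_pos ⟨by simp only [letter]; omega, by omega⟩]
  rw [formula, mem_sem_readN, sem, Set.mem_union, mem_sem_errorFormula, pointerErrorFormula,
    mem_sem_foldr_differs, mem_sem_tagErrorFormula, mem_sem_iterate_tagErrorFormula, inputError_iff]
  simp only [h0, hl]

end

/-- The formula is valid if and only if the machine gets stuck. -/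
theorem valid_formula_iff (D : Type*) [Infinite D] (n : ℕ) :
    Valid D (M.formula n) ↔ ∃ j, M.action n (j + 1) = none := by
  constructor
  · intro h
    by_contra! hn
    let e := Infinite.natEmbedding D
    have he : Function.Injective e := e.injective
    let a : Tag → D := fun T => e (letter T - 15)
    have ha : Function.Injective a := fun T S hTS => by
      have h1 := he hTS
      simp only [letter] at h1
      exact (Fintype.equivFin Tag).injective (Fin.ext (by omega))
    -- Letters and identities are both drawn from `e` and may coincide: no test compares a letter
    -- with an identity.
    let t : Trace D := fun m => if m < Fintype.card Tag + 1 then e m else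
      M.trace a e n (m - (Fintype.card Tag + 1))
    have ht : shift (Fintype.card Tag + 1) t = M.trace a e n := by
      funext m
      have h1 : ¬ Fintype.card Tag + 1 + m < Fintype.card Tag + 1 := by omega
      simp only [shift, t, if_neg h1, Nat.add_sub_cancel_left]
    have hz : t 0 = e 0 := if_pos (by omega)
    have hta : (fun T : Tag => t (letter T - 15)) = a := by
      funext T
      have := letter_lt T
      exact if_pos (by omega)
    have H := h (fun _ _ => ∅) e t
    rw [mem_sem_formula, ht, hz, hta] at H
    rcases H with ⟨i, j, hij, H⟩ | H
    · exact not_errorAt_trace ha he hn hij H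
    · exact not_inputError_trace a e n H
  · rintro ⟨j, hj⟩ ρ δ t
    rw [mem_sem_formula]
    by_contra! H
    exact action_ne_none_of_no_error H.2 H.1 j hj

/-! ### Membership in the fragment and the input restrictions -/

theorem isDisj_iterate_tagErrorFormula (T : Tag) (n : ℕ) {φ : Formula} (h : φ.IsDisj) :
    ((tagErrorFormula T)^[n] φ).IsDisj := by
  induction n with
  | zero => exact h
  | succ n ih =>
    rw [Function.iterate_succ_apply']
    exact ⟨trivial, isDisj_skip.2 ih⟩

theorem isDisj_formula (n : ℕ) : (M.formula n).IsDisj := by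
  have h := isDisj_iterate_tagErrorFormula M.inp n (φ := differs (letter M.start)) trivial
  rw [formula]
  generalize (tagErrorFormula M.inp)^[n] (differs (letter M.start)) = φ at h ⊢
  simp [errorFormula, pointerErrorFormula, tagErrorFormula, ev, IsDisj, isDisj_readN,
    isDisj_skip, h, differs]

theorem iterate_tagErrorFormula_props (T S : Tag) (n : ℕ) :
    ((tagErrorFormula T)^[n] (differs (letter S))).freeFVars = ∅ ∧
    ((tagErrorFormula T)^[n] (differs (letter S))).Guarded ∧
    ((tagErrorFormula T)^[n] (differs (letter S))).binders = [] ∧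
    ((tagErrorFormula T)^[n] (differs (letter S))).freeDVars ⊆
      Finset.Ico 16 (16 + Fintype.card Tag) := by
  have hl : ∀ T : Tag, (differs (letter T)).freeDVars ⊆ Finset.Ico 16 (16 + Fintype.card Tag) := by
    intro T
    simp [differs, freeDVars, BExp.vars, Term.vars, letter]
  induction n with
  | zero => exact ⟨rfl, trivial, rfl, hl S⟩
  | succ n ih =>
    obtain ⟨h1, h2, h3, h4⟩ := ih
    rw [Function.iterate_succ_apply']
    generalize (tagErrorFormula T)^[n] (differs (letter S)) = φ at h1 h2 h3 h4 ⊢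
    refine ⟨?_, ⟨trivial, guarded_skip.2 h2⟩, ?_, Finset.union_subset (hl T) ?_⟩
    · simp [tagErrorFormula, freeFVars, freeFVars_skip, h1, differs]
    · simp [tagErrorFormula, binders, binders_skip, h3, differs]
    · rwa [freeDVars_skip]

theorem isSentence_formula (n : ℕ) : (M.formula n).IsSentence := by
  obtain ⟨h1, h2, h3, h4⟩ := iterate_tagErrorFormula_props M.inp M.start n
  rw [formula]
  generalize (tagErrorFormula M.inp)^[n] (differs (letter M.start)) = φ at h1 h2 h3 h4 ⊢
  refine ⟨⟨?_, ?_⟩, ?_, ?_⟩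
  · refine Finset.eq_empty_of_forall_notMem fun x hx => ?_
    obtain ⟨hx, hx15⟩ := mem_freeDVars_readN hx
    have hx' : ¬ (15 ≤ x ∧ x < 16 + Fintype.card Tag) := by omega
    rw [freeDVars, Finset.mem_union] at hx
    rcases hx with hx | hx
    · simp only [errorFormula, ev, freeDVars, freeDVars_skip, Finset.union_empty] at hx
      obtain ⟨hx, hx0⟩ := mem_freeDVars_readN hx
      simp only [freeDVars, freeDVars_skip, Finset.union_empty] at hx
      obtain ⟨hx, hx5⟩ := mem_freeDVars_readN hx
      simp only [freeDVars, Finset.union_empty] at hx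
      have := Finset.mem_range.1 (M.vars_errorConstraint hx)
      omega
    · have hnil := letter_lt M.nil
      have hnil' : 16 ≤ letter M.nil := by simp only [letter]; omega
      simp [pointerErrorFormula, tagErrorFormula, differs, freeDVars, freeDVars_skip, BExp.vars,
        Term.vars] at hx
      rcases hx with rfl | rfl | hx
      · omega
      · omega
      · have := Finset.mem_Ico.1 (h4 hx)
        omega
  · simp [errorFormula, pointerErrorFormula, tagErrorFormula, ev, freeFVars,
      freeFVars_readN, freeFVars_skip, h1, differs]
  · simp [errorFormula, pointerErrorFormula, tagErrorFormula, ev, Guarded,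
      guarded_readN, guarded_skip, h2, differs, unguardedFVars, unguardedFVars_readN_succ,
      unguardedFVars_skip_succ]
  · simp [errorFormula, pointerErrorFormula, tagErrorFormula, ev, binders,
      binders_readN, binders_skip, h3, differs]

/-! ### Computability of the formula and of its dual -/

theorem isContext_pointerErrorFormula : IsContext pointerErrorFormula := by
  suffices ∀ l : List ℕ, IsContext fun φ => l.foldr (fun m ψ => or (skip m (differs 15)) ψ) φ from
    this _
  intro l
  induction l with
  | nil => exact IsContext.id
  | cons m l ih => exact (IsContext.or_right _).comp ih

theorem isContext_tagErrorFormula (T : Tag) : IsContext (tagErrorFormula T) :=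
  (IsContext.or_right _).comp (IsContext.skip 5)

theorem primrec_formula : Primrec M.formula ∧ Primrec fun n => (M.formula n).dual :=
  IsContext.primrec_iterate ((IsContext.readN _ _).comp ((IsContext.or_right _).comp
    (isContext_pointerErrorFormula.comp (isContext_tagErrorFormula _))))
    (isContext_tagErrorFormula _) _

end LogMachine

end RecHMLd

namespace RecHMLd

/-! ### A log machine that evaluates codes of partial recursive functions -/

open Turing.ToPartrec StateTransition

/-- The head of a code with subcodes in `C`. -/
inductive Instr (C : Type) : Type
  | zero'
  | succ
  | tail
  | cons (f g : C)
  | comp (f g : C)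
  | case (f g : C)
  | fix (f : C)

/-- The code with a given head, if `den` gives the codes of the elements of `C`. -/
def Instr.code {C : Type} (den : C → Code) : Instr C → Code
  | .zero' => .zero'
  | .succ => .succ
  | .tail => .tail
  | .cons f g => .cons (den f) (den g)
  | .comp f g => .comp (den f) (den g)
  | .case f g => .case (den f) (den g)
  | .fix f => .fix (den f)

/-- The subcodes of a code. -/
def subcodes : Code → List Code
  | .zero' => [.zero']
  | .succ => [.succ]
  | .tail => [.tail]
  | .cons f g => .cons f g :: (subcodes f ++ subcodes g)
  | .comp f g => .comp f g :: (subcodes f ++ subcodes g)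
  | .case f g => .case f g :: (subcodes f ++ subcodes g)
  | .fix f => .fix f :: subcodes f

theorem self_mem_subcodes (c : Code) : c ∈ subcodes c := by
  cases c <;> simp [subcodes]

theorem subcodes_trans {c d : Code} (h : d ∈ subcodes c) : subcodes d ⊆ subcodes c := by
  induction c with
  | zero' | succ | tail =>
    simp only [subcodes, List.mem_singleton] at h
    subst h
    exact List.Subset.refl _
  | cons f g ihf ihg | comp f g ihf ihg | case f g ihf ihg =>
    simp only [subcodes, List.mem_cons, List.mem_append] at h
    rcases h with rfl | h | h
    · exact List.Subset.refl _
    · exact fun x hx => List.mem_cons_of_mem _ (List.mem_append_left _ (ihf h hx))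
    · exact fun x hx => List.mem_cons_of_mem _ (List.mem_append_right _ (ihg h hx))
  | fix f ihf =>
    simp only [subcodes, List.mem_cons] at h
    rcases h with rfl | h
    · exact List.Subset.refl _
    · exact fun x hx => List.mem_cons_of_mem _ (ihf h hx)

/-- Every code can be given by a finite table. -/
theorem exists_prog (c : Code) : ∃ (C : Type) (_ : Finite C) (prog : C → Instr C) (den : C → Code)
    (root : C), den root = c ∧ ∀ x, den x = (prog x).code den := by
  -- Tags carry codes as parameters and each tag needs a letter, so only the finitely many subcodes
  -- of `c` may occur.
  refine ⟨{x // x ∈ subcodes c}, List.finite_toSet (subcodes c), fun x => match x with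
    | ⟨.zero', _⟩ => .zero'
    | ⟨.succ, _⟩ => .succ
    | ⟨.tail, _⟩ => .tail
    | ⟨.cons f g, h⟩ => .cons ⟨f, subcodes_trans h (by simp [subcodes, self_mem_subcodes])⟩
        ⟨g, subcodes_trans h (by simp [subcodes, self_mem_subcodes])⟩
    | ⟨.comp f g, h⟩ => .comp ⟨f, subcodes_trans h (by simp [subcodes, self_mem_subcodes])⟩
        ⟨g, subcodes_trans h (by simp [subcodes, self_mem_subcodes])⟩
    | ⟨.case f g, h⟩ => .case ⟨f, subcodes_trans h (by simp [subcodes, self_mem_subcodes])⟩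
        ⟨g, subcodes_trans h (by simp [subcodes, self_mem_subcodes])⟩
    | ⟨.fix f, h⟩ => .fix ⟨f, subcodes_trans h (by simp [subcodes, self_mem_subcodes])⟩,
    Subtype.val, ⟨c, self_mem_subcodes c⟩, rfl, ?_⟩
  rintro ⟨x, hx⟩
  cases x <;> rfl

/-- The tags of the evaluator. Records `eval x` and `ret` are its control states, with a pointer `k`
to a continuation and a pointer `v` to a list. Records are also data: `nil` is the number zero, the
empty list and the empty continuation, `inp` and `succ` are the successor of the number `u`,
`cellEval x` and `cellRet` are lists with head `u` and tail `v`, and `eval x` and `restore x` are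
continuations. -/
inductive Tag (C : Type) : Type
  | nil
  | inp
  | halt
  | eval (x : C)
  | ret
  | restore (x : C)
  | head
  | cellRet
  | cellEval (x : C)
  | succ
  | branch (f g : C)
  | loopHead (x : C)
  | loopTest (x : C)
  | loopExit

instance (C : Type) [Finite C] : Finite (Tag C) := by
  refine Finite.of_injective (β := Fin 14 × Option (C × C)) (fun
    | .nil => (0, none)
    | .inp => (1, none)
    | .halt => (2, none)
    | .eval x => (3, some (x, x))
    | .ret => (4, none)
    | .restore x => (5, some (x, x))
    | .head => (6, none)
    | .cellRet => (7, none)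
    | .cellEval x => (8, some (x, x))
    | .succ => (9, none)
    | .branch f g => (10, some (f, g))
    | .loopHead x => (11, some (x, x))
    | .loopTest x => (12, some (x, x))
    | .loopExit => (13, none)) ?_
  intro a b h
  cases a <;> cases b <;> simp_all

/-- The sources for the three pointers of a record. -/
def Src.triple (k v u : Src) : Ptr → Src
  | .k => k
  | .v => v
  | .u => u

section

variable {C : Type} (prog : C → Instr C)

/-- The pointer that the evaluator follows. -/
def evaluatorLook : Tag C → Ptr
  | .eval _ => .v
  | .head => .u
  | .branch _ _ => .u
  | .loopHead _ => .v
  | .loopTest _ => .u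
  | _ => .k

/-- The new record has the tag `T` and the given pointers. -/
def emit (T : Tag C) (k v u : Src) : Option (Option (Tag C) × (Ptr → Src)) :=
  some (some T, Src.triple k v u)

/-- The action of the evaluator in the state `eval`. -/
def evalAct (x : C) : Option (Option (Tag C) × (Ptr → Src)) :=
  match prog x with
  | .zero' => emit .cellRet (.cur .k) (.cur .v) .zero
  | .succ => emit .succ (.cur .k) .zero (.old .u)
  | .tail => emit .ret (.cur .k) (.old .v) .zero
  -- With `.self` the current record becomes the continuation; it already holds the argument list
  -- and the outer continuation.
  | .cons f _ => emit (.eval f) .self (.cur .v) .zero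
  | .comp _ g => emit (.eval g) .self (.cur .v) .zero
  | .case f g => emit (.branch f g) (.cur .k) (.old .v) (.old .u)
  | .fix f => emit (.eval f) .self (.cur .v) .zero

/-- The action of the evaluator in the state `ret` for a continuation with a given tag. -/
def retAct : Tag C → Option (Option (Tag C) × (Ptr → Src))
  | .nil => emit .halt .zero .zero .zero
  | .restore _ => emit .head (.old .k) (.cur .v) (.old .v)
  | .eval x =>
    match prog x with
    | .cons _ g => emit (.restore g) (.old .k) (.cur .v) (.old .v)
    | .comp f _ => emit (.eval f) (.old .k) (.cur .v) .zero
    -- Here `.cur .k` keeps the `fix` record as the continuation for another round; `loopExit` later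
    -- replaces it by the outer one.
    | .fix f => emit (.loopHead f) (.cur .k) (.cur .v) .zero
    | _ => none
  | _ => none

/-- The actions of the evaluator. -/
def evaluatorAct : Tag C → Tag C → Option (Option (Tag C) × (Ptr → Src))
  | .nil, _ => some (none, Src.triple .zero .zero .self)
  | .inp, _ => some (none, Src.triple .zero .zero .self)
  | .halt, _ => none
  | .eval x, _ => evalAct prog x
  | .ret, S => retAct prog S
  | .restore x, _ => emit (.eval x) .self (.cur .u) .zero
  -- A step follows a single pointer, so longer accesses are spread over auxiliary records such as
  -- `head` and `loopTest`.
  | .head, _ => emit .cellRet (.cur .k) (.cur .v) (.old .u)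
  | .cellRet, _ => emit .ret (.cur .k) .self .zero
  | .cellEval x, _ => emit (.eval x) (.cur .k) .self .zero
  | .succ, _ => emit .cellRet (.cur .k) .zero .self
  | .branch _ g, .succ => emit (.cellEval g) (.cur .k) (.cur .v) (.old .u)
  | .branch _ g, .inp => emit (.cellEval g) (.cur .k) (.cur .v) (.old .u)
  | .branch f _, _ => emit (.eval f) (.cur .k) (.cur .v) .zero
  | .loopHead x, _ => emit (.loopTest x) (.cur .k) (.old .v) (.old .u)
  | .loopTest x, .succ => emit (.eval x) (.cur .k) (.cur .v) .zero
  | .loopTest x, .inp => emit (.eval x) (.cur .k) (.cur .v) .zero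
  | .loopTest _, _ => emit .loopExit (.cur .k) (.cur .v) .zero
  | .loopExit, _ => emit .ret (.old .k) (.cur .v) .zero

theorem emit_eq_some {T : Tag C} {k v u : Src} {o : Option (Tag C)} {s : Ptr → Src}
    (h : emit T k v u = some (o, s)) : o = some T := by
  simp only [emit, Option.some.injEq, Prod.mk.injEq] at h
  exact h.1.symm

/-- The evaluator of the code `root`. -/
def evaluator (root : C) : LogMachine (Tag C) where
  nil := .nil
  inp := .inp
  -- As a cell, the start record has the numeral of `n` as head, the empty list as tail and the
  -- empty continuation, so `root` is run on `[n]`.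
  start := .cellEval root
  look := evaluatorLook
  act := evaluatorAct prog
  start_ne := by simp
  act_input := by
    rintro T S (rfl | rfl) <;> exact ⟨_, rfl, rfl, rfl, rfl⟩
  act_not_input := by
    intro T S o s hT h
    unfold evaluatorAct at h
    split at h
    case h_4 =>
      unfold evalAct at h
      split at h <;> exact ⟨_, emit_eq_some h, by simp⟩
    case h_5 =>
      unfold retAct at h
      split at h
      case h_3 => split at h <;> first | exact ⟨_, emit_eq_some h, by simp⟩ | cases h
      all_goals first | exact ⟨_, emit_eq_some h, by simp⟩ | cases h
    all_goals first | exact ⟨_, emit_eq_some h, by simp⟩ | (simp at hT; done) | cases h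

/-! ### Linked data in the log and the simulation of the evaluation -/

variable (root : C) (den : C → Code) (n : ℕ)

/-- The records of the evaluator. -/
def record : ℕ → Rec (Tag C) := (evaluator prog root).log n

/-- The step function on the positions of the log. -/
def position (j : ℕ) : Option ℕ := ((evaluator prog root).action n j).map fun _ => j + 1

local notation "R" => record prog root n

/-- The pointer `p` stands for a number. -/
def NatRep : ℕ → ℕ → Prop
  | 0, p => p = 0
  | m + 1, p => ((R p).tag = .succ ∨ (R p).tag = .inp) ∧ NatRep m ((R p).ptr .u)

/-- The pointer `p` stands for a list. -/
def ListRep : List ℕ → ℕ → Prop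
  | [], p => p = 0
  | m :: l, p => NatRep prog root n m ((R p).ptr .u) ∧ ListRep l ((R p).ptr .v)

/-- The pointer `p` stands for a continuation. -/
def ContRep : Cont → ℕ → Prop
  | .halt, p => p = 0
  | .cons₁ c l k, p => (∃ x f g, (R p).tag = .eval x ∧ prog x = .cons f g ∧ den g = c) ∧
      ListRep prog root n l ((R p).ptr .v) ∧ ContRep k ((R p).ptr .k)
  | .cons₂ l k, p => (∃ x, (R p).tag = .restore x) ∧
      ListRep prog root n l ((R p).ptr .v) ∧ ContRep k ((R p).ptr .k)
  | .comp c k, p => (∃ x f g, (R p).tag = .eval x ∧ prog x = .comp f g ∧ den f = c) ∧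
      ContRep k ((R p).ptr .k)
  | .fix c k, p => (∃ x f, (R p).tag = .eval x ∧ prog x = .fix f ∧ den f = c) ∧
      ContRep k ((R p).ptr .k)

/-- The record `j` stands for a configuration. -/
def CfgRep : Cfg → ℕ → Prop
  | .halt _, j => (R j).tag = .halt
  | .ret k l, j => (R j).tag = .ret ∧ ContRep prog root den n k ((R j).ptr .k) ∧
      ListRep prog root n l ((R j).ptr .v)

variable {prog root den n}

theorem record_zero : R 0 = ⟨.nil, fun _ => 0⟩ := LogMachine.log_zero _ n

/-- For the empty list this works because record 0 points to itself, which matches the convention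
that the default head is 0. -/
theorem NatRep.headI {l : List ℕ} {p : ℕ} (h : ListRep prog root n l p) :
    NatRep prog root n l.headI ((R p).ptr .u) := by
  cases l with
  | nil =>
    cases h
    rw [record_zero]
    rfl
  | cons m l => exact h.1

theorem ListRep.tail {l : List ℕ} {p : ℕ} (h : ListRep prog root n l p) :
    ListRep prog root n l.tail ((R p).ptr .v) := by
  cases l with
  | nil =>
    cases h
    rw [record_zero]
    rfl
  | cons m l => exact h.2

theorem record_succ {j : ℕ} {T T' : Tag C} {k v u : Src} (hT : (R j).tag = T)
    (h : evaluatorAct prog T (R ((R j).ptr (evaluatorLook T))).tag = emit T' k v u) :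
    Reaches₁ (position prog root n) j (j + 1) ∧ (R (j + 1)).tag = T' ∧
      (R (j + 1)).ptr .k = k.val j (R ((R j).ptr (evaluatorLook T))) (R j) ∧
      (R (j + 1)).ptr .v = v.val j (R ((R j).ptr (evaluatorLook T))) (R j) ∧
      (R (j + 1)).ptr .u = u.val j (R ((R j).ptr (evaluatorLook T))) (R j) := by
  subst hT
  have ha : (evaluator prog root).action n j = some (some T', Src.triple k v u) := h
  have h1 := LogMachine.log_succ_of_action _ ha
  refine ⟨Relation.TransGen.single ?_, ?_⟩
  · simp [position, ha]
  · rw [record, h1]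
    exact ⟨rfl, rfl, rfl, rfl⟩

theorem cfgRep_of_cellRet {j : ℕ} {k : Cont} {m : ℕ} {l : List ℕ} (hT : (R j).tag = .cellRet)
    (hk : ContRep prog root den n k ((R j).ptr .k)) (hu : NatRep prog root n m ((R j).ptr .u))
    (hv : ListRep prog root n l ((R j).ptr .v)) :
    ∃ j', Reaches₁ (position prog root n) j j' ∧ CfgRep prog root den n (.ret k (m :: l)) j' := by
  obtain ⟨h1, h2, h3, h4, -⟩ := record_succ hT rfl
  refine ⟨_, h1, h2, ?_, ?_⟩
  · rw [h3]; exact hk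
  · rw [h4]; exact ⟨hu, hv⟩

section

variable (hden : ∀ x, den x = (prog x).code den)

include hden

/-- Induction on the code, since `stepNormal` descends into subcodes within one step. Records are
never changed, so record `j` can serve as a continuation ever after. The strict `Reaches₁` is what
`Respects` asks for. -/
theorem exists_cfgRep_stepNormal {c : Code} {k : Cont} {l : List ℕ} {j : ℕ} {x : C}
    (hc : den x = c) (hT : (R j).tag = .eval x) (hk : ContRep prog root den n k ((R j).ptr .k))
    (hv : ListRep prog root n l ((R j).ptr .v)) :
    ∃ j', Reaches₁ (position prog root n) j j' ∧
      CfgRep prog root den n (stepNormal c k l) j' := by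
  induction c generalizing k l j x with
  | zero' =>
    have hx := hden x
    cases hp : prog x <;> rw [hp, hc] at hx <;> cases hx
    obtain ⟨h1, h2, h3, h4, h5⟩ := record_succ (T' := .cellRet) (k := .cur .k) (v := .cur .v)
      (u := .zero) hT (by simp [evaluatorAct, evalAct, hp])
    obtain ⟨j', h6, h7⟩ := cfgRep_of_cellRet (m := 0) h2 (by rw [h3]; exact hk) (by rw [h5]; exact rfl) (by rw [h4]; exact hv)
    exact ⟨j', h1.trans h6, h7⟩
  | succ =>
    have hx := hden x
    cases hp : prog x <;> rw [hp, hc] at hx <;> cases hx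
    obtain ⟨h1, h2, h3, h4, h5⟩ := record_succ (T' := .succ) (k := .cur .k) (v := .zero)
      (u := .old .u) hT (by simp [evaluatorAct, evalAct, hp])
    obtain ⟨g1, g2, g3, g4, g5⟩ := record_succ h2 rfl
    have hu : NatRep prog root n (l.headI + 1) (j + 1) := ⟨Or.inl h2, (by rw [h5]; exact NatRep.headI hv)⟩
    obtain ⟨j', h6, h7⟩ := cfgRep_of_cellRet (m := l.headI + 1) (l := []) g2
      (by rw [g3.trans h3]; exact hk) (by rw [g5]; exact hu) (by rw [g4]; exact rfl)
    exact ⟨j', (h1.trans g1).trans h6, h7⟩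
  | tail =>
    have hx := hden x
    cases hp : prog x <;> rw [hp, hc] at hx <;> cases hx
    obtain ⟨h1, h2, h3, h4, h5⟩ := record_succ (T' := .ret) (k := .cur .k) (v := .old .v)
      (u := .zero) hT (by simp [evaluatorAct, evalAct, hp])
    exact ⟨_, h1, h2, (by rw [h3]; exact hk), (by rw [h4]; exact hv.tail)⟩
  | cons f g ihf ihg =>
    have hx := hden x
    cases hp : prog x <;> rw [hp, hc] at hx <;> cases hx
    rename_i f g
    obtain ⟨h1, h2, h3, h4, h5⟩ := record_succ (T' := .eval f) (k := .self) (v := .cur .v)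
      (u := .zero) hT (by simp [evaluatorAct, evalAct, hp])
    have hk' : ContRep prog root den n (.cons₁ (den g) l k) j := ⟨⟨x, f, g, hT, hp, rfl⟩, hv, hk⟩
    obtain ⟨j', h6, h7⟩ := ihf rfl h2 (by rw [h3]; exact hk') (by rw [h4]; exact hv)
    exact ⟨j', h1.trans h6, h7⟩
  | comp f g ihf ihg =>
    have hx := hden x
    cases hp : prog x <;> rw [hp, hc] at hx <;> cases hx
    rename_i f g
    obtain ⟨h1, h2, h3, h4, h5⟩ := record_succ (T' := .eval g) (k := .self) (v := .cur .v)
      (u := .zero) hT (by simp [evaluatorAct, evalAct, hp])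
    have hk' : ContRep prog root den n (.comp (den f) k) j := ⟨⟨x, f, g, hT, hp, rfl⟩, hk⟩
    obtain ⟨j', h6, h7⟩ := ihg rfl h2 (by rw [h3]; exact hk') (by rw [h4]; exact hv)
    exact ⟨j', h1.trans h6, h7⟩
  | case f g ihf ihg =>
    have hx := hden x
    cases hp : prog x <;> rw [hp, hc] at hx <;> cases hx
    rename_i f g
    obtain ⟨h1, h2, h3, h4, h5⟩ := record_succ (T' := .branch f g) (k := .cur .k) (v := .old .v)
      (u := .old .u) hT (by simp [evaluatorAct, evalAct, hp])
    have hu : NatRep prog root n l.headI ((R (j + 1)).ptr .u) := (by rw [h5]; exact NatRep.headI hv)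
    have hv' : ListRep prog root n l.tail ((R (j + 1)).ptr .v) := (by rw [h4]; exact hv.tail)
    simp only [stepNormal]
    generalize l.headI = m at hu ⊢
    rcases m with _ | m
    · obtain ⟨g1, g2, g3, g4, g5⟩ := record_succ (T' := .eval f) (k := .cur .k) (v := .cur .v)
        (u := .zero) h2 (by
          rw [show (R (j + 1)).ptr (evaluatorLook (.branch f g)) = 0 from hu, record_zero]; rfl)
      obtain ⟨j', h6, h7⟩ := ihf rfl g2 (by rw [g3.trans h3]; exact hk) (by rw [g4]; exact hv')
      exact ⟨j', (h1.trans g1).trans h6, h7⟩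
    · obtain ⟨g1, g2, g3, g4, g5⟩ := record_succ (T' := .cellEval g) (k := .cur .k) (v := .cur .v)
        (u := .old .u) h2 (by
          rcases hu.1 with e | e <;>
            rw [show (R ((R (j + 1)).ptr (evaluatorLook (.branch f g)))).tag = _ from e] <;> rfl)
      obtain ⟨e1, e2, e3, e4, e5⟩ := record_succ g2 rfl
      have hv'' : ListRep prog root n (m :: l.tail) (j + 1 + 1) := ⟨(by rw [g5]; exact hu.2), (by rw [g4]; exact hv')⟩
      obtain ⟨j', h6, h7⟩ := ihg rfl e2 (by rw [(e3.trans g3).trans h3]; exact hk) (by rw [e4]; exact hv'')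
      exact ⟨j', ((h1.trans g1).trans e1).trans h6, h7⟩
  | fix f ihf =>
    have hx := hden x
    cases hp : prog x <;> rw [hp, hc] at hx <;> cases hx
    rename_i f
    obtain ⟨h1, h2, h3, h4, h5⟩ := record_succ (T' := .eval f) (k := .self) (v := .cur .v)
      (u := .zero) hT (by simp [evaluatorAct, evalAct, hp])
    have hk' : ContRep prog root den n (.fix (den f) k) j := ⟨⟨x, f, hT, hp, rfl⟩, hk⟩
    obtain ⟨j', h6, h7⟩ := ihf rfl h2 (by rw [h3]; exact hk') (by rw [h4]; exact hv)
    exact ⟨j', h1.trans h6, h7⟩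

/-- Induction on the continuation: after `cons₂`, and on leaving a loop, `stepRet` goes on to the
inner continuation within the same step. -/
theorem exists_cfgRep_stepRet {k : Cont} {l : List ℕ} {j : ℕ}
    (h : CfgRep prog root den n (.ret k l) j) :
    ∃ j', Reaches₁ (position prog root n) j j' ∧ CfgRep prog root den n (stepRet k l) j' := by
  induction k generalizing l j with
  | halt =>
    obtain ⟨hT, hk, hv⟩ := h
    obtain ⟨h1, h2, -⟩ := record_succ (T' := .halt) (k := .zero) (v := .zero) (u := .zero) hT (by
      rw [show (R j).ptr (evaluatorLook .ret) = 0 from hk, record_zero]; rfl)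
    exact ⟨_, h1, h2⟩
  | cons₁ c l' k ih =>
    obtain ⟨hT, hk, hv⟩ := h
    obtain ⟨⟨x, f, g, hx, hp, hc⟩, hl, hk⟩ := hk
    obtain ⟨h1, h2, h3, h4, h5⟩ := record_succ (T' := .restore g) (k := .old .k) (v := .cur .v)
      (u := .old .v) hT (by
        rw [show (R ((R j).ptr (evaluatorLook .ret))).tag = _ from hx]
        simp [evaluatorAct, retAct, hp])
    obtain ⟨g1, g2, g3, g4, g5⟩ := record_succ h2 rfl
    have hk' : ContRep prog root den n (.cons₂ l k) (j + 1) := ⟨⟨g, h2⟩, (by rw [h4]; exact hv), (by rw [h3]; exact hk)⟩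
    obtain ⟨j', h6, h7⟩ := exists_cfgRep_stepNormal hden (l := l') hc g2 (by rw [g3]; exact hk') (by rw [g4.trans h5]; exact hl)
    exact ⟨j', (h1.trans g1).trans h6, h7⟩
  | cons₂ l' k ih =>
    obtain ⟨hT, hk, hv⟩ := h
    obtain ⟨⟨x, hx⟩, hl, hk⟩ := hk
    obtain ⟨h1, h2, h3, h4, h5⟩ := record_succ (T' := .head) (k := .old .k) (v := .cur .v)
      (u := .old .v) hT (by
        rw [show (R ((R j).ptr (evaluatorLook .ret))).tag = _ from hx]; rfl)
    obtain ⟨g1, g2, g3, g4, g5⟩ := record_succ h2 rfl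
    have hl' : ListRep prog root n l' ((R (j + 1)).ptr .u) := by rw [h5]; exact hl
    obtain ⟨j1, e1, e2, e3, e4⟩ := cfgRep_of_cellRet (k := k) (m := l'.headI) (l := l) g2
      (by rw [g3.trans h3]; exact hk) (by rw [g5]; exact NatRep.headI hl')
      (by rw [g4.trans h4]; exact hv)
    obtain ⟨j', h6, h7⟩ := ih ⟨e2, e3, e4⟩
    exact ⟨j', ((h1.trans g1).trans e1).trans h6, h7⟩
  | comp c k ih =>
    obtain ⟨hT, hk, hv⟩ := h
    obtain ⟨⟨x, f, g, hx, hp, hc⟩, hk⟩ := hk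
    obtain ⟨h1, h2, h3, h4, h5⟩ := record_succ (T' := .eval f) (k := .old .k) (v := .cur .v)
      (u := .zero) hT (by
        rw [show (R ((R j).ptr (evaluatorLook .ret))).tag = _ from hx]
        simp [evaluatorAct, retAct, hp])
    obtain ⟨j', h6, h7⟩ := exists_cfgRep_stepNormal hden hc h2 (by rw [h3]; exact hk) (by rw [h4]; exact hv)
    exact ⟨j', h1.trans h6, h7⟩
  | fix c k ih =>
    obtain ⟨hT, hk, hv⟩ := h
    have hk0 := hk
    obtain ⟨⟨x, f, hx, hp, hc⟩, hk⟩ := hk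
    obtain ⟨h1, h2, h3, h4, -⟩ := record_succ (T' := .loopHead f) (k := .cur .k) (v := .cur .v)
      (u := .zero) hT (by
        rw [show (R ((R j).ptr (evaluatorLook .ret))).tag = _ from hx]
        simp [evaluatorAct, retAct, hp])
    obtain ⟨g1, g2, g3, g4, g5⟩ := record_succ h2 rfl
    have hv1 : ListRep prog root n l ((R (j + 1)).ptr .v) := by rw [h4]; exact hv
    have hu : NatRep prog root n l.headI ((R (j + 1 + 1)).ptr .u) := by
      rw [g5]; exact NatRep.headI hv1
    have hv2 : ListRep prog root n l.tail ((R (j + 1 + 1)).ptr .v) := by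
      rw [g4]; exact hv1.tail
    have hk2 : (R (j + 1 + 1)).ptr .k = (R j).ptr .k := g3.trans h3
    simp only [stepRet]
    generalize l.headI = m at hu ⊢
    rcases m with _ | m
    · obtain ⟨e1, e2, e3, e4, -⟩ := record_succ (T' := .loopExit) (k := .cur .k) (v := .cur .v)
        (u := .zero) g2 (by
          rw [show (R (j + 1 + 1)).ptr (evaluatorLook (.loopTest f)) = 0 from hu, record_zero]
          rfl)
      obtain ⟨d1, d2, d3, d4, -⟩ := record_succ e2 rfl
      obtain ⟨j', h6, h7⟩ := ih (l := l.tail) (j := j + 1 + 1 + 1 + 1) ⟨d2, by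
        rw [d3]
        change ContRep prog root den n k ((R ((R (j + 1 + 1 + 1)).ptr .k)).ptr .k)
        rw [e3]
        change ContRep prog root den n k ((R ((R (j + 1 + 1)).ptr .k)).ptr .k)
        rw [hk2]
        exact hk, by rw [d4.trans e4]; exact hv2⟩
      exact ⟨j', ((((h1.trans g1).trans e1).trans d1)).trans h6, h7⟩
    · obtain ⟨e1, e2, e3, e4, -⟩ := record_succ (T' := .eval f) (k := .cur .k) (v := .cur .v)
        (u := .zero) g2 (by
          rcases hu.1 with e | e <;>
            rw [show (R ((R (j + 1 + 1)).ptr (evaluatorLook (.loopTest f)))).tag = _ from e] <;> rfl)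
      obtain ⟨j', h6, h7⟩ := exists_cfgRep_stepNormal hden (k := .fix c k) hc e2
        (by rw [e3.trans hk2]; exact hk0) (by rw [e4]; exact hv2)
      exact ⟨j', ((h1.trans g1).trans e1).trans h6, h7⟩

theorem respects_position :
    Respects step (position prog root n) (CfgRep prog root den n) := by
  rintro (l | ⟨k, l⟩) j h
  · change (R j).tag = .halt at h
    have : (evaluator prog root).action n j = none := by
      rw [LogMachine.action, show ((evaluator prog root).log n j).tag = _ from h]
      rfl
    simp [step, position, this]
  · obtain ⟨j', h1, h2⟩ := exists_cfgRep_stepRet hden h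
    exact ⟨j', h2, h1⟩

/-- The evaluator gets stuck if and only if the code has a value. -/
theorem evaluator_stuck_iff : (∃ j, (evaluator prog root).action n (j + 1) = none) ↔
    ((den root).eval [n]).Dom := by
  have hstart : (R (n + 1)).tag = .cellEval root := by
    rw [record, LogMachine.tag_log_of_le _ le_rfl, LogMachine.inputTag_succ_self]
    rfl
  have hinp : ∀ m ≤ n, NatRep prog root n m m := by
    intro m
    induction m with
    | zero => exact fun _ => rfl
    | succ m ih =>
      intro hm
      refine ⟨Or.inr ?_, ?_⟩
      · rw [record, LogMachine.tag_log_of_le _ (by omega), LogMachine.inputTag, if_pos hm]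
        rfl
      · rw [record, (LogMachine.log_input _ (show m ≤ n by omega)).2.2]
        exact ih (by omega)
  obtain ⟨hk, hv, hu⟩ := LogMachine.log_input (evaluator prog root) (le_refl n)
  obtain ⟨h1, h2, h3, h4, -⟩ := record_succ hstart rfl
  have hl : ListRep prog root n [n] (n + 1) := by
    refine ⟨?_, hv⟩
    rw [record, hu]
    exact hinp n le_rfl
  obtain ⟨j, h5, h6⟩ := exists_cfgRep_stepNormal hden (k := .halt) rfl h2
    (by rw [h3]; exact hk) (by rw [h4]; exact hl)
  have hdom := tr_eval_dom (respects_position hden) h6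
  rw [stepNormal_eval, ← reaches_eval (h1.trans h5).to_reflTransGen] at hdom
  refine Iff.trans ?_ hdom
  have hnone : ∀ i, position prog root n i = none ↔ (evaluator prog root).action n i = none := by
    intro i
    simp [position]
  constructor
  · rintro ⟨i, hi⟩
    -- Input records always act, so the machine cannot be stuck before record `n + 1`.
    have hni : n + 1 ≤ i + 1 := by
      by_contra hlt
      obtain ⟨s, hs, -⟩ := (evaluator prog root).act_input ((evaluator prog root).log n (i + 1)).tag
        ((evaluator prog root).log n ((evaluator prog root).lookup n (i + 1))).tag
        (LogMachine.tag_log_of_le (evaluator prog root) (show i + 1 ≤ n + 1 by omega) ▸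
          LogMachine.inputTag_of_le _ (by omega))
      rw [LogMachine.action, hs] at hi
      cases hi
    -- Since `position` moves from `m` to `m + 1` or stops, termination propagates from the stuck
    -- record back to `n + 1`.
    refine Nat.decreasingInduction
      (motive := fun m _ => (StateTransition.eval (position prog root n) m).Dom)
      (fun m _ ih => ?_) (Part.dom_iff_mem.2 ⟨_, mem_eval.2 ⟨.refl, (hnone _).2 hi⟩⟩) hni
    rcases ha : position prog root n m with _ | m'
    · exact Part.dom_iff_mem.2 ⟨_, mem_eval.2 ⟨.refl, ha⟩⟩
    · obtain ⟨_, _, rfl⟩ := Option.map_eq_some_iff.1 ha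
      rwa [reaches_eval (Relation.ReflTransGen.single ha)]
  · intro h
    obtain ⟨i, hi⟩ := Part.dom_iff_mem.1 h
    obtain ⟨hi1, hi2⟩ := mem_eval.1 hi
    have hle : n + 1 ≤ i := by
      clear hi hi2
      induction hi1 with
      | refl => exact le_rfl
      | tail _ hab ih =>
        obtain ⟨_, _, rfl⟩ := Option.map_eq_some_iff.1 hab
        omega
    refine ⟨i - 1, ?_⟩
    rw [Nat.sub_add_cancel (by omega)]
    exact (hnone i).1 hi2

end

end

end RecHMLd

namespace RecHMLd

/-! ### Reductions -/

open Turing.ToPartrec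

/-- Every r.e. predicate is the domain of a code on singleton lists. -/
theorem exists_code_of_rePred {p : ℕ → Prop} (hp : REPred p) :
    ∃ c : Code, ∀ n, (c.eval [n]).Dom ↔ p n := by
  have hf : Partrec fun n : ℕ => (Part.assert (p n) fun _ => Part.some ()).map fun _ => 0 :=
    Partrec.map hp (Computable.const 0).to₂
  obtain ⟨c, hc⟩ := Code.exists_code (Nat.Partrec'.part_iff₁.2 hf)
  refine ⟨c, fun n => ?_⟩
  have h := hc (n ::ᵥ List.Vector.nil)
  rw [show (n ::ᵥ List.Vector.nil : List.Vector ℕ 1).1 = [n] from rfl] at h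
  rw [h]
  simp [Part.assert]

theorem exists_reduction (D : Type*) [Infinite D] {p : ℕ → Prop} (hp : REPred p) :
    ∃ f : ℕ → Formula, Computable f ∧ Computable (fun n => (f n).dual) ∧
      ∀ n, (f n).IsDisj ∧ (f n).IsSentence ∧ (p n ↔ Valid D (f n)) := by
  obtain ⟨c, hc⟩ := exists_code_of_rePred hp
  obtain ⟨C, _, prog, den, root, rfl, hden⟩ := exists_prog c
  have := Fintype.ofFinite (Tag C)
  obtain ⟨h1, h2⟩ := (evaluator prog root).primrec_formula
  exact ⟨_, h1.to_comp, h2.to_comp, fun n => ⟨LogMachine.isDisj_formula _ n,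
    LogMachine.isSentence_formula _ n, by
      rw [LogMachine.valid_formula_iff, evaluator_stuck_iff hden, hc]⟩⟩

theorem reducesTo_valid (D : Type*) [Infinite D] {p : ℕ → Prop} (hp : REPred p) :
    ReducesTo p (fun φ => φ.IsDisj ∧ φ.IsSentence) (Valid D) := by
  obtain ⟨f, h1, -, h⟩ := exists_reduction D hp
  exact ⟨f, h1, fun n => ⟨⟨(h n).1, (h n).2.1⟩, (h n).2.2⟩⟩

theorem reducesTo_satisfiable (D : Type*) [Infinite D] {p : ℕ → Prop} (hp : REPred p) :
    ReducesTo (fun n => ¬ p n) (fun φ => φ.IsConj ∧ φ.IsSentence) (Satisfiable D) := by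
  obtain ⟨f, -, h2, h⟩ := exists_reduction D hp
  refine ⟨_, h2, fun n => ⟨⟨(f n).isConj_dual_iff.2 (h n).1, (f n).isSentence_dual_iff.2 (h n).2.1⟩,
    ?_⟩⟩
  change ¬ p n ↔ _
  rw [(h n).2.2, valid_iff_not_satisfiable_dual, not_not]

/-- A decider need only be right on `S`; this suffices because the reduction takes its values in
`S`. -/
theorem computablePred_of_reducesTo {p : ℕ → Prop} {S P : Formula → Prop} (h : ReducesTo p S P)
    (hd : ¬ Undecidable S P) : ComputablePred p := by
  obtain ⟨f, hf, hfp⟩ := h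
  obtain ⟨g, hg, hgp⟩ := not_not.1 hd
  refine ComputablePred.computable_iff.2 ⟨fun n => g (f n), hg.comp hf, funext fun n => ?_⟩
  exact propext ((hfp n).2.trans (hgp _ (hfp n).1).symm)

/-- There is an r.e. predicate on the natural numbers that is not computable. -/
theorem exists_rePred_not_computablePred : ∃ p : ℕ → Prop, REPred p ∧ ¬ ComputablePred p := by
  refine ⟨fun n => ((Denumerable.ofNat Nat.Partrec.Code n).eval 0).Dom, ?_, fun h => ?_⟩
  · exact Partrec.comp (ComputablePred.halting_problem_re 0) (Computable.ofNat _)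
  · refine ComputablePred.halting_problem 0 ?_
    obtain ⟨f, hf, e⟩ := ComputablePred.computable_iff.1 h
    refine ComputablePred.computable_iff.2
      ⟨fun c => f (Encodable.encode c), hf.comp Computable.encode, funext fun c => ?_⟩
    have := congrFun e (Encodable.encode c)
    simpa using this

end RecHMLd

theorem mainTheorem8 (D : Type*) [Countable D] [Infinite D] :
    -- validity of disjHMLd is undecidable
    RecHMLd.Undecidable (fun φ => φ.IsDisj ∧ φ.IsSentence) (RecHMLd.Valid D) ∧
    -- satisfiability of the dual fragment conjHMLd is undecidable
    RecHMLd.Undecidable (fun φ => φ.IsConj ∧ φ.IsSentence) (RecHMLd.Satisfiable D) ∧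
    -- the two problems are complements of each other under dualisation
    (∀ φ : RecHMLd.Formula,
      φ.dual.dual = φ ∧ (φ.IsDisj ↔ φ.dual.IsConj) ∧ (φ.IsSentence ↔ φ.dual.IsSentence) ∧
      (RecHMLd.Valid D φ ↔ ¬ RecHMLd.Satisfiable D φ.dual)) ∧
    -- every r.e. predicate (such as halting) reduces to validity of disjHMLd, and its
    -- complement (such as non-halting) to satisfiability of conjHMLd
    (∀ p : ℕ → Prop, REPred p →
      RecHMLd.ReducesTo p (fun φ => φ.IsDisj ∧ φ.IsSentence) (RecHMLd.Valid D) ∧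
      RecHMLd.ReducesTo (fun n => ¬ p n) (fun φ => φ.IsConj ∧ φ.IsSentence)
        (RecHMLd.Satisfiable D)) := by
  obtain ⟨p, hp, hp'⟩ := RecHMLd.exists_rePred_not_computablePred
  refine ⟨by_contra fun h => hp' ?_, by_contra fun h => hp' ?_, fun φ => ⟨φ.dual_dual,
    φ.isConj_dual_iff.symm, φ.isSentence_dual_iff.symm, RecHMLd.valid_iff_not_satisfiable_dual D φ⟩,
    fun p hp => ⟨RecHMLd.reducesTo_valid D hp, RecHMLd.reducesTo_satisfiable D hp⟩⟩
  · exact RecHMLd.computablePred_of_reducesTo (RecHMLd.reducesTo_valid D hp) h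
  · exact (RecHMLd.computablePred_of_reducesTo (RecHMLd.reducesTo_satisfiable D hp) h).not.of_eq
      fun _ => not_not
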